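/- **Setting.** Let $K$ be the algebra of entire functions $s$ on $\mathbb C$ with $s(u+1)=s(u)$ and $|s(u)|\le Ce^{p|\operatorname{Im}u|}$ for some $C,p>0$ depending on $s$, with scalar product $\langle s,t\rangle=\frac1{2\pi i}\int_{-1/2}^{1/2}s(u)t(u)\,du$. Put $j_n(u)=e^{2\pi inu}$ and $j^n(u)=2\pi i\,e^{-2\pi inu}$ for $n\in\mathbb Z$. Let $h,e,f$ be the standard basis of $\mathfrak{sl}_2(\mathbb C)$ ($[h,e]=2e$, $[h,f]=-2f$, $[e,f]=h$) and $(x,y)=\operatorname{tr}(xy)$. The Lie algebra $\hat{\mathfrak g}=\mathfrak u_\tau(\widehat{\mathfrak{sl}}_2)$ is $(\mathfrak{sl}_2\otimes K)\oplus\mathbb Cc\oplus\mathbb Cd$ where, writing $\hat x[s]=x\otimes s$, the element $c$ is central, $[d,\hat x[s]]=\hat x[s']$ and $[\hat x[s],\hat y[t]]=\widehat{[x,y]}[st]+(x,y)\langle s',t\rangle\,c$. Its invariant scalar product is $\langle\hat x[s],\hat y[t]\rangle=(x,y)\langle s,t\rangle$, $\langle c,d\rangle=1$, $\langle c,c\rangle=\langle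 d,d\rangle=\langle c,\hat x[s]\rangle=\langle d,\hat x[s]\rangle=0$. Through it, $\hat{\mathfrak g}^{\otimes k}$ ($k=2,3$) is embedded in the space of linear functionals on $\hat{\mathfrak g}^{\otimes k}$; infinite series, and derivatives with respect to parameters, are taken weakly, i.e. after pairing with each element of $\hat{\mathfrak g}^{\otimes k}$. For $a\in\hat{\mathfrak g}$, the products $a_{\mathbf 1}R_{\mathbf{23}}$, $a_{\mathbf 2}R_{\mathbf{13}}$, $a_{\mathbf 3}R_{\mathbf{12}}$ are obtained by placing $a$ in the slot with its index and the two slots of $R$ in the remaining positions. **Statement.** For all $\tau,\lambda\in\mathbb C$ with $\operatorname{Im}\tau>0$ and $\lambda\notin\mathbb Z+\tau\mathbb Z$, the series $$\mathfrak r_\lambda=\frac14\hat h[j^0]\otimes\hat h[j_0]+\frac12\sum_{n\ne0}\frac{\hat h[j^n]\otimes\hat h[j_n]}{1-e^{2\pi in\tau}}+\sum_{n\in\mathbb Z}\frac{\hat e[j^n]\otimes\hat f[j_n]}{1-e^{2\pi i(n\tau+\lambda)}}+\sum_{n\in\mathbb Z}\frac{\hat f[j^n]\otimes\hat e[j_n]}{1-e^{2\pi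 i(n\tau-\lambda)}}+c\otimes d$$ converges and is differentiable in $\lambda$ and in $\tau$; the double series obtained by expanding the commutators $[\mathfrak r_{\lambda,\mathbf{12}},\mathfrak r_{\lambda,\mathbf{13}}]$, $[\mathfrak r_{\lambda,\mathbf{12}},\mathfrak r_{\lambda,\mathbf{23}}]$, $[\mathfrak r_{\lambda,\mathbf{13}},\mathfrak r_{\lambda,\mathbf{23}}]$ term by term converge; and, with $h=\hat h[j_0]$, $$[\mathfrak r_{\lambda,\mathbf{12}},\mathfrak r_{\lambda,\mathbf{13}}]+[\mathfrak r_{\lambda,\mathbf{12}},\mathfrak r_{\lambda,\mathbf{23}}]+[\mathfrak r_{\lambda,\mathbf{13}},\mathfrak r_{\lambda,\mathbf{23}}]=h_{\mathbf1}\tfrac{\partial}{\partial\lambda}\mathfrak r_{\lambda,\mathbf{23}}-h_{\mathbf2}\tfrac{\partial}{\partial\lambda}\mathfrak r_{\lambda,\mathbf{13}}+h_{\mathbf3}\tfrac{\partial}{\partial\lambda}\mathfrak r_{\lambda,\mathbf{12}}-c_{\mathbf1}\tfrac{\partial}{\partial\tau}\mathfrak r_{\lambda,\mathbf{23}}+c_{\mathbf2}\tfrac{\partial}{\partial\tau}\mathfrak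 r_{\lambda,\mathbf{13}}-c_{\mathbf3}\tfrac{\partial}{\partial\tau}\mathfrak r_{\lambda,\mathbf{12}}.$$ -/

import Mathlib

open scoped TensorProduct

noncomputable section

namespace EllipticCurrent

/-! ### The test function algebra on the cylinder -/

/-- The algebra `K = K(Cyl)` of entire functions `s` with `s (u + 1) = s u` and
`|s u| ≤ C * exp (p * |Im u|)` for some `C, p > 0` depending on `s`. -/
def K : Subalgebra ℂ (ℂ → ℂ) where
  carrier := {s | Differentiable ℂ s ∧ (∀ u, s (u + 1) = s u) ∧
    ∃ C p : ℝ, 0 < C ∧ 0 < p ∧ ∀ u, ‖s u‖ ≤ C * Real.exp (p * |u.im|)}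
  mul_mem' := by
    rintro s t ⟨hs, hs1, C, p, hC, hp, hsb⟩ ⟨ht, ht1, C', p', hC', hp', htb⟩
    refine ⟨hs.mul ht, fun u => by simp [hs1, ht1], C * C', p + p', by positivity,
      by positivity, fun u => ?_⟩
    rw [Pi.mul_apply, norm_mul, add_mul, Real.exp_add]
    calc ‖s u‖ * ‖t u‖ ≤ (C * Real.exp (p * |u.im|)) * (C' * Real.exp (p' * |u.im|)) :=
          mul_le_mul (hsb u) (htb u) (norm_nonneg _) (by positivity)
      _ = _ := by ring
  add_mem' := by
    rintro s t ⟨hs, hs1, C, p, hC, hp, hsb⟩ ⟨ht, ht1, C', p', hC', hp', htb⟩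
    refine ⟨hs.add ht, fun u => by simp [hs1, ht1], C + C', p + p', by positivity,
      by positivity, fun u => ?_⟩
    have h1 : Real.exp (p * |u.im|) ≤ Real.exp ((p + p') * |u.im|) := by
      gcongr; linarith
    have h2 : Real.exp (p' * |u.im|) ≤ Real.exp ((p + p') * |u.im|) := by
      gcongr; linarith
    calc ‖(s + t) u‖ ≤ ‖s u‖ + ‖t u‖ := norm_add_le _ _
      _ ≤ C * Real.exp (p * |u.im|) + C' * Real.exp (p' * |u.im|) := add_le_add (hsb u) (htb u)
      _ ≤ C * Real.exp ((p + p') * |u.im|) + C' * Real.exp ((p + p') * |u.im|) := by gcongr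
      _ = _ := by ring
  algebraMap_mem' := by
    intro r
    refine ⟨differentiable_const r, fun _ => rfl, ‖r‖ + 1, 1, by positivity, one_pos,
      fun u => ?_⟩
    have h1 : (1 : ℝ) ≤ Real.exp (1 * |u.im|) := Real.one_le_exp (by positivity)
    change ‖r‖ ≤ _
    nlinarith [norm_nonneg r]

theorem deriv_mem_K {s : ℂ → ℂ} (hs : s ∈ K) : deriv s ∈ K := by
  obtain ⟨hd, h1, C, p, hC, hp, hb⟩ := hs
  refine ⟨hd.deriv, fun u => ?_, C * Real.exp p, p, by positivity, hp, fun u => ?_⟩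
  · rw [← deriv_comp_add_const]
    congr 1
    exact funext h1
  · have h := Complex.norm_deriv_le_of_forall_mem_sphere_norm_le (c := u) (R := 1)
      (C := C * Real.exp p * Real.exp (p * |u.im|)) (f := s) one_pos hd.diffContOnCl ?_
    · simpa using h
    · intro z hz
      refine (hb z).trans ?_
      rw [mul_assoc, ← Real.exp_add]
      have hz' : ‖z - u‖ = 1 := by simpa [dist_eq_norm] using hz
      have h2 : |z.im - u.im| ≤ 1 := by
        have := Complex.abs_im_le_norm (z - u)
        rwa [hz', Complex.sub_im] at this
      have h3 : |z.im| ≤ 1 + |u.im| := by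
        have := abs_add_le (z.im - u.im) u.im
        rw [sub_add_cancel] at this
        linarith
      have h4 : p * |z.im| ≤ p + p * |u.im| := by nlinarith
      gcongr

theorem K_differentiable (s : K) : Differentiable ℂ (s : ℂ → ℂ) := s.2.1

theorem K_continuous_ofReal (s : K) : Continuous fun x : ℝ => (s : ℂ → ℂ) x :=
  (K_differentiable s).continuous.comp Complex.continuous_ofReal

/-- The derivation `s ↦ s'` of `K`. -/
def derivK : Derivation ℂ K K :=
  Derivation.mk'
    { toFun := fun s => ⟨deriv (s : ℂ → ℂ), deriv_mem_K s.2⟩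
      map_add' := fun s t => Subtype.ext <| funext fun u =>
        deriv_add (K_differentiable s u) (K_differentiable t u)
      map_smul' := fun r s => Subtype.ext <| funext fun u =>
        deriv_const_smul r (K_differentiable s u) }
    (fun s t => Subtype.ext <| funext fun u => by
      have h := deriv_mul (K_differentiable s u) (K_differentiable t u)
      change deriv ((s : ℂ → ℂ) * (t : ℂ → ℂ)) u
        = (s : ℂ → ℂ) u * deriv (t : ℂ → ℂ) u + (t : ℂ → ℂ) u * deriv (s : ℂ → ℂ) u
      rw [h]; ring)

theorem K_intervalIntegrable (s t : K) : IntervalIntegrable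
    (fun x : ℝ => (s : ℂ → ℂ) x * (t : ℂ → ℂ) x) MeasureTheory.volume (-(1 / 2)) (1 / 2) :=
  ((K_continuous_ofReal s).mul (K_continuous_ofReal t)).intervalIntegrable _ _

/-- The scalar product `⟨s, t⟩ = (2πi)⁻¹ ∫_{-1/2}^{1/2} s(u) t(u) du` on `K`. -/
def formK : K →ₗ[ℂ] K →ₗ[ℂ] ℂ :=
  LinearMap.mk₂ ℂ
    (fun s t => (2 * Real.pi * Complex.I)⁻¹ *
      ∫ x : ℝ in (-(1 / 2))..(1 / 2), (s : ℂ → ℂ) x * (t : ℂ → ℂ) x)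
    (fun s s' t => by
      rw [← mul_add, ← intervalIntegral.integral_add (K_intervalIntegrable s t)
        (K_intervalIntegrable s' t)]
      simp [add_mul])
    (fun r s t => by
      rw [smul_eq_mul, mul_left_comm, ← intervalIntegral.integral_const_mul]
      simp [mul_assoc])
    (fun s t t' => by
      rw [← mul_add, ← intervalIntegral.integral_add (K_intervalIntegrable s t)
        (K_intervalIntegrable s t')]
      simp [mul_add])
    (fun r s t => by
      rw [smul_eq_mul, mul_left_comm, ← intervalIntegral.integral_const_mul]
      simp [mul_left_comm])

theorem formK_apply (s t : K) : formK s t = (2 * Real.pi * Complex.I)⁻¹ *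
    ∫ x : ℝ in (-(1 / 2))..(1 / 2), (s : ℂ → ℂ) x * (t : ℂ → ℂ) x := rfl

theorem formK_comm (s t : K) : formK s t = formK t s := by
  simp only [formK_apply, mul_comm]

theorem formK_mul (s t v : K) : formK (s * t) v = formK s (t * v) := by
  simp [formK_apply, mul_assoc]

theorem formK_deriv (s t : K) : formK (derivK s) t = - formK s (derivK t) := by
  have hd : ∀ (w : K) (x : ℝ), HasDerivAt (fun x : ℝ => (w : ℂ → ℂ) x)
      ((derivK w : ℂ → ℂ) x) x := fun w x =>
    (K_differentiable w x).hasDerivAt.comp_ofReal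
  have hs := intervalIntegral.integral_mul_deriv_eq_deriv_mul (a := -(1 / 2)) (b := 1 / 2)
    (fun x _ => hd s x) (fun x _ => hd t x)
    ((K_continuous_ofReal (derivK s)).intervalIntegrable _ _)
    ((K_continuous_ofReal (derivK t)).intervalIntegrable _ _)
  have hper : ∀ w : K, (w : ℂ → ℂ) ((1 / 2 : ℝ) : ℂ) = (w : ℂ → ℂ) ((-(1 / 2) : ℝ) : ℂ) := by
    intro w
    have h : ((1 / 2 : ℝ) : ℂ) = ((-(1 / 2) : ℝ) : ℂ) + 1 := by
      push_cast
      norm_num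
    rw [h, w.2.2.1]
  rw [hper s, hper t, sub_self, zero_sub] at hs
  rw [formK_apply, formK_apply, hs]
  ring

/-! ### The current algebra -/

/-- The Lie algebra `sl₂` of traceless complex `2 × 2` matrices. -/
abbrev sl2 : Type := LieAlgebra.SpecialLinear.sl (Fin 2) ℂ

/-- The basis element `h = diag(1, -1)`. -/
def hh : sl2 := ⟨!![1, 0; 0, -1], by
  change Matrix.trace (!![1, 0; 0, -1] : Matrix (Fin 2) (Fin 2) ℂ) = 0
  simp [Matrix.trace_fin_two]⟩

/-- The basis element `e`. -/
def ee : sl2 := ⟨!![0, 1; 0, 0], by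
  change Matrix.trace (!![0, 1; 0, 0] : Matrix (Fin 2) (Fin 2) ℂ) = 0
  simp [Matrix.trace_fin_two]⟩

/-- The basis element `f`. -/
def ff : sl2 := ⟨!![0, 0; 1, 0], by
  change Matrix.trace (!![0, 0; 1, 0] : Matrix (Fin 2) (Fin 2) ℂ) = 0
  simp [Matrix.trace_fin_two]⟩

/-- The invariant scalar product `(x, y) = tr (x y)` on `sl₂`. -/
def formA : sl2 →ₗ[ℂ] sl2 →ₗ[ℂ] ℂ :=
  LinearMap.mk₂ ℂ (fun x y => Matrix.trace (x.1 * y.1))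
    (fun x x' y => by simp [add_mul])
    (fun r x y => by simp)
    (fun x y y' => by simp [mul_add])
    (fun r x y => by simp)

theorem formA_apply (x y : sl2) :
    formA x y = Matrix.trace (x.1 * y.1) := rfl

theorem formA_comm (x y : sl2) : formA x y = formA y x := by
  rw [formA_apply, formA_apply, Matrix.trace_mul_comm]

theorem formA_lie (x y z : sl2) : formA ⁅x, y⁆ z = formA x ⁅y, z⁆ := by
  simp only [formA_apply, LieSubalgebra.coe_bracket, Ring.lie_def, sub_mul, mul_sub,
    Matrix.trace_sub]
  congr 1
  · rw [mul_assoc]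
  · rw [mul_assoc, Matrix.trace_mul_comm, mul_assoc]

/-- The loop algebra `sl₂ ⊗ K`, with the bracket `[x ⊗ s, y ⊗ t]₀ = [x, y] ⊗ s t`. The factor
`K` is written on the left. -/
abbrev Loop : Type := K ⊗[ℂ] sl2

instance : AddCommGroup Loop := TensorProduct.addCommGroup

instance : LieRing Loop := LieAlgebra.ExtendScalars.instLieRing ℂ K sl2

instance : LieAlgebra ℂ Loop := LieAlgebra.ExtendScalars.instBaseLieAlgebra ℂ K sl2

/-- `x ⊗ s ↦ x ⊗ s'`. -/
def loopDeriv : Loop →ₗ[ℂ] Loop := LinearMap.rTensor sl2 (derivK : K →ₗ[ℂ] K)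

/-- `⟨x ⊗ s, y ⊗ t⟩ = (x, y) ⟨s, t⟩`. -/
def loopForm : Loop →ₗ[ℂ] Loop →ₗ[ℂ] ℂ :=
  TensorProduct.dualDistrib ℂ K sl2 ∘ₗ TensorProduct.map formK formA

theorem loopDeriv_tmul (s : K) (x : sl2) :
    loopDeriv (s ⊗ₜ x) = derivK s ⊗ₜ x := rfl

theorem loopForm_tmul (s t : K) (x y : sl2) :
    loopForm (s ⊗ₜ x) (t ⊗ₜ y) = formK s t * formA x y := rfl

theorem loop_induction₂ {P : Loop → Loop → Prop}
    (h0 : ∀ Y, P 0 Y) (h0' : ∀ X, P X 0)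
    (ha : ∀ X X' Y, P X Y → P X' Y → P (X + X') Y)
    (ha' : ∀ X Y Y', P X Y → P X Y' → P X (Y + Y'))
    (ht : ∀ (s t : K) (x y : sl2), P (s ⊗ₜ x) (t ⊗ₜ y)) (X Y : Loop) : P X Y := by
  induction X using TensorProduct.induction_on with
  | zero => exact h0 Y
  | add X X' h h' => exact ha X X' Y h h'
  | tmul s x =>
    induction Y using TensorProduct.induction_on with
    | zero => exact h0' _
    | add Y Y' h h' => exact ha' _ Y Y' h h'
    | tmul t y => exact ht s t x y

theorem loopForm_comm (X Y : Loop) : loopForm X Y = loopForm Y X := by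
  induction X, Y using loop_induction₂ with
  | h0 Y => simp
  | h0' X => simp
  | ha X X' Y h h' => simp [h, h']
  | ha' X Y Y' h h' => simp [h, h']
  | ht s t x y => rw [loopForm_tmul, loopForm_tmul, formK_comm, formA_comm]

theorem loopForm_deriv (X Y : Loop) : loopForm (loopDeriv X) Y = - loopForm X (loopDeriv Y) := by
  induction X, Y using loop_induction₂ with
  | h0 Y => simp
  | h0' X => simp
  | ha X X' Y h h' => simp [h, h']; ring
  | ha' X Y Y' h h' => simp [h, h']; ring
  | ht s t x y =>
    rw [loopDeriv_tmul, loopDeriv_tmul, loopForm_tmul, loopForm_tmul, formK_deriv]; ring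

theorem loopDeriv_lie (X Y : Loop) :
    loopDeriv ⁅X, Y⁆ = ⁅loopDeriv X, Y⁆ + ⁅X, loopDeriv Y⁆ := by
  induction X, Y using loop_induction₂ with
  | h0 Y => simp
  | h0' X => simp
  | ha X X' Y h h' => simp only [add_lie, map_add, h, h']; abel
  | ha' X Y Y' h h' => simp only [lie_add, map_add, h, h']; abel
  | ht s t x y =>
    simp only [LieAlgebra.ExtendScalars.bracket_tmul, loopDeriv_tmul, Derivation.leibniz,
      smul_eq_mul, TensorProduct.add_tmul]
    rw [add_comm, mul_comm t]

theorem loopForm_lie (X Y Z : Loop) : loopForm ⁅X, Y⁆ Z = loopForm X ⁅Y, Z⁆ := by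
  induction Z using TensorProduct.induction_on with
  | zero => simp
  | add Z Z' h h' => simp [h, h']
  | tmul v z =>
    induction X, Y using loop_induction₂ with
    | h0 Y => simp
    | h0' X => simp
    | ha X X' Y h h' => simp [h, h']
    | ha' X Y Y' h h' => simp [h, h']
    | ht s t x y =>
      simp only [LieAlgebra.ExtendScalars.bracket_tmul, loopForm_tmul, formK_mul, formA_lie]

/-- The current algebra `u_τ(ŝl₂) = (sl₂ ⊗ K) ⊕ ℂ ⊕ ℂ`; the last two coordinates are those of
`c` and `d`. As a Lie algebra it does not depend on `τ`. -/
def Current : Type := Loop × ℂ × ℂ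

instance : AddCommGroup Current := inferInstanceAs (AddCommGroup (Loop × ℂ × ℂ))

instance : Module ℂ Current := inferInstanceAs (Module ℂ (Loop × ℂ × ℂ))

namespace Current

/-- The component in `sl₂ ⊗ K`. -/
def loop : Current →ₗ[ℂ] Loop := LinearMap.fst ℂ Loop (ℂ × ℂ)

/-- The coefficient of `c`. -/
def cen : Current →ₗ[ℂ] ℂ := LinearMap.fst ℂ ℂ ℂ ∘ₗ LinearMap.snd ℂ Loop (ℂ × ℂ)

/-- The coefficient of `d`. -/
def coc : Current →ₗ[ℂ] ℂ := LinearMap.snd ℂ ℂ ℂ ∘ₗ LinearMap.snd ℂ Loop (ℂ × ℂ)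

/-- The element `(X, a, b)`. -/
def mk (X : Loop) (a b : ℂ) : Current := (X, a, b)

@[simp] theorem loop_mk (X : Loop) (a b : ℂ) : loop (mk X a b) = X := rfl

@[simp] theorem cen_mk (X : Loop) (a b : ℂ) : cen (mk X a b) = a := rfl

@[simp] theorem coc_mk (X : Loop) (a b : ℂ) : coc (mk X a b) = b := rfl

@[ext] theorem ext {x y : Current} (h : loop x = loop y) (h' : cen x = cen y)
    (h'' : coc x = coc y) : x = y := Prod.ext h (Prod.ext h' h'')

/-- The bracket with `c` central, `[d, x̂[s]] = x̂[s']` and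
`[x̂[s], ŷ[t]] = ([x ⊗ s, y ⊗ t]₀, 0, 0) + (x, y) ⟨s', t⟩ c`. -/
instance : Bracket Current Current where
  bracket x y := mk
    (⁅loop x, loop y⁆ + coc x • loopDeriv (loop y) - coc y • loopDeriv (loop x))
    (loopForm (loopDeriv (loop x)) (loop y)) 0

theorem lie_def (x y : Current) : ⁅x, y⁆ = mk
    (⁅loop x, loop y⁆ + coc x • loopDeriv (loop y) - coc y • loopDeriv (loop x))
    (loopForm (loopDeriv (loop x)) (loop y)) 0 := rfl

instance : LieRing Current where
  add_lie x y z := by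
    ext
    · simp only [lie_def, loop_mk, map_add, add_lie, add_smul, smul_add]; abel
    · simp [lie_def]
    · simp [lie_def]
  lie_add x y z := by
    ext
    · simp only [lie_def, loop_mk, map_add, lie_add, add_smul, smul_add]; abel
    · simp [lie_def]
    · simp [lie_def]
  lie_self x := by
    ext
    · simp [lie_def]
    · have h := loopForm_deriv (loop x) (loop x)
      rw [loopForm_comm (loop x)] at h
      simpa [lie_def] using self_eq_neg.mp h
    · simp [lie_def]
  leibniz_lie x y z := by
    ext
    · simp only [lie_def, loop_mk, coc_mk, map_add, map_sub, map_smul, lie_add, add_lie, lie_sub,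
        sub_lie, lie_smul, smul_lie, loopDeriv_lie, smul_add, smul_sub, zero_smul,
        leibniz_lie (loop x) (loop y) (loop z), smul_comm (coc y) (coc x)]
      simp only [smul_comm (coc z) (coc x), smul_comm (coc z) (coc y),
        ← lie_skew (loopDeriv (loop x)) (loop y)]
      simp only [smul_neg]
      abel
    · simp only [lie_def, loop_mk, cen_mk, map_add, map_sub, map_smul, LinearMap.add_apply,
        LinearMap.sub_apply, LinearMap.smul_apply, loopDeriv_lie, smul_eq_mul]
      have h1 : loopForm ⁅loopDeriv (loop x), loop y⁆ (loop z)
          = loopForm (loopDeriv (loop x)) ⁅loop y, loop z⁆ := loopForm_lie _ _ _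
      have h2 : loopForm ⁅loop x, loopDeriv (loop y)⁆ (loop z)
          = - loopForm (loopDeriv (loop y)) ⁅loop x, loop z⁆ := by
        rw [← lie_skew, map_neg, LinearMap.neg_apply, loopForm_lie]
      have h3 : loopForm (loopDeriv (loopDeriv (loop y))) (loop z)
          = - loopForm (loopDeriv (loop y)) (loopDeriv (loop z)) := loopForm_deriv _ _
      have h4 : loopForm (loopDeriv (loopDeriv (loop x))) (loop z)
          = - loopForm (loopDeriv (loop x)) (loopDeriv (loop z)) := loopForm_deriv _ _
      have h5 : loopForm (loopDeriv (loop x)) (loopDeriv (loop y))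
          = loopForm (loopDeriv (loop y)) (loopDeriv (loop x)) := loopForm_comm _ _
      rw [h1, h2, h3, h4, h5]
      ring
    · simp [lie_def]

instance : LieAlgebra ℂ Current where
  lie_smul r x y := by
    ext
    · simp [lie_def, smul_sub, smul_add, smul_smul, mul_comm]
    · simp [lie_def]
    · simp [lie_def]

/-- The invariant scalar product of the current algebra:
`⟨x̂[s], ŷ[t]⟩ = (x, y) ⟨s, t⟩`, `⟨c, d⟩ = 1`, and `c`, `d` are isotropic and orthogonal to all
`x̂[s]`. -/
def form : Current →ₗ[ℂ] Current →ₗ[ℂ] ℂ :=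
  loopForm.compl₁₂ loop loop + (LinearMap.mul ℂ ℂ).compl₁₂ cen coc
    + (LinearMap.mul ℂ ℂ).compl₁₂ coc cen

end Current

/-- The element `x̂[s] = (x ⊗ s, 0, 0)`. -/
def cur (x : sl2) (s : K) : Current := Current.mk (s ⊗ₜ x) 0 0

/-- The central element `c`. -/
def cc : Current := Current.mk 0 1 0

/-- The co-central element `d`. -/
def dd : Current := Current.mk 0 0 1

/-- The functions `j_n(u) = e^{2πinu}`. -/
def jLow (n : ℤ) : K := ⟨fun u => Complex.exp (2 * Real.pi * Complex.I * n * u), by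
  refine ⟨by fun_prop, fun u => ?_, 1, 2 * Real.pi * |(n : ℝ)| + 1, one_pos, by positivity,
    fun u => ?_⟩
  · change Complex.exp (2 * Real.pi * Complex.I * n * (u + 1))
      = Complex.exp (2 * Real.pi * Complex.I * n * u)
    rw [mul_add, Complex.exp_add, mul_one, mul_comm (2 * (Real.pi : ℂ) * Complex.I) (n : ℂ),
      Complex.exp_int_mul_two_pi_mul_I, mul_one]
  · rw [Complex.norm_exp, one_mul]
    apply Real.exp_le_exp.mpr
    have h : (2 * Real.pi * Complex.I * n * u : ℂ).re = 2 * Real.pi * (-(n * u.im)) := by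
      simp [Complex.mul_re, Complex.mul_im]; ring
    rw [h]
    have h1 : -((n : ℝ) * u.im) ≤ |(n : ℝ)| * |u.im| := by
      rw [← abs_mul]; exact neg_le_abs _
    have h2 := mul_le_mul_of_nonneg_left h1 Real.two_pi_pos.le
    nlinarith [abs_nonneg u.im]⟩

/-- The dual functions `j^n(u) = 2πi e^{-2πinu}`. -/
def jUp (n : ℤ) : K := (2 * Real.pi * Complex.I : ℂ) • jLow (-n)

/-! ### Completed tensor powers

Both tensor powers are embedded by the invariant scalar product into the spaces of distributions,
that is, of linear functionals on the tensor powers of the current algebra, where series converge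
weakly. (On `K` all linear functionals are continuous.) -/

/-- `ĝ ⊗ ĝ`. -/
abbrev T2 : Type := Current ⊗[ℂ] Current

/-- `ĝ ⊗ ĝ ⊗ ĝ`. -/
abbrev T3 : Type := Current ⊗[ℂ] T2

/-- `a ⊗ b` as the functional `x ⊗ y ↦ ⟨a, x⟩ ⟨b, y⟩`. -/
def emb2 : T2 →ₗ[ℂ] Module.Dual ℂ T2 :=
  TensorProduct.dualDistrib ℂ Current Current ∘ₗ TensorProduct.map Current.form Current.form

/-- `a ⊗ b ⊗ c` as the functional `x ⊗ y ⊗ z ↦ ⟨a, x⟩ ⟨b, y⟩ ⟨c, z⟩`. -/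
def emb3 : T3 →ₗ[ℂ] Module.Dual ℂ T3 :=
  TensorProduct.dualDistrib ℂ Current T2 ∘ₗ TensorProduct.map Current.form emb2

/-- The series `∑ f i` of elements of `ĝ ⊗ ĝ` converges weakly to `R`. -/
def HasSum2 {ι : Type} (f : ι → T2) (R : Module.Dual ℂ T2) : Prop :=
  ∀ φ : T2, HasSum (fun i => emb2 (f i) φ) (R φ)

/-- The series `∑ f i` of elements of `ĝ ⊗ ĝ ⊗ ĝ` converges weakly to `R`. -/
def HasSum3 {ι : Type} (f : ι → T3) (R : Module.Dual ℂ T3) : Prop :=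
  ∀ φ : T3, HasSum (fun i => emb3 (f i) φ) (R φ)

/-- `R'` is the weak derivative at `z` of the family `R`. -/
def HasDeriv2 (R : ℂ → Module.Dual ℂ T2) (R' : Module.Dual ℂ T2) (z : ℂ) : Prop :=
  ∀ φ : T2, HasDerivAt (fun w => R w φ) (R' φ) z

/-- `a₁ R₂₃`. -/
def mul1_23 (a : Current) (R : Module.Dual ℂ T2) : Module.Dual ℂ T3 :=
  TensorProduct.dualDistrib ℂ Current T2 (Current.form a ⊗ₜ R)

/-- `a₂ R₁₃`. -/
def mul2_13 (a : Current) (R : Module.Dual ℂ T2) : Module.Dual ℂ T3 :=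
  mul1_23 a R ∘ₗ (TensorProduct.leftComm ℂ Current Current Current).toLinearMap

/-- `a₃ R₁₂`. -/
def mul3_12 (a : Current) (R : Module.Dual ℂ T2) : Module.Dual ℂ T3 :=
  mul1_23 a R ∘ₗ (TensorProduct.comm ℂ T2 Current).toLinearMap ∘ₗ
    (TensorProduct.assoc ℂ Current Current Current).symm.toLinearMap

/-! ### The brackets of the classical Yang-Baxter equation -/

/-- The Lie bracket of the current algebra as a bilinear map. -/
def lieB : Current →ₗ[ℂ] Current →ₗ[ℂ] Current :=
  LinearMap.mk₂ ℂ (fun x y => ⁅x, y⁆) add_lie smul_lie lie_add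
    (fun r x y => lie_smul r x y)

/-- `[t₁₂, t'₁₃]`: `(a ⊗ b, a' ⊗ b') ↦ [a, a'] ⊗ b ⊗ b'`. -/
def br12_13 : T2 →ₗ[ℂ] T2 →ₗ[ℂ] T3 :=
  TensorProduct.map₂ lieB (TensorProduct.mk ℂ Current Current)

/-- `[t₁₂, t'₂₃]`: `(a ⊗ b, a' ⊗ b') ↦ a ⊗ [b, a'] ⊗ b'`. -/
def br12_23 : T2 →ₗ[ℂ] T2 →ₗ[ℂ] T3 :=
  TensorProduct.lift (LinearMap.mk₂ ℂ
    (fun a b => TensorProduct.mk ℂ Current T2 a ∘ₗ LinearMap.rTensor Current (lieB b))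
    (fun a a' b => by ext; simp)
    (fun r a b => by ext; simp [TensorProduct.smul_tmul'])
    (fun a b b' => by ext; simp [TensorProduct.tmul_add])
    (fun r a b => by ext; simp))

/-- `[t₁₃, t'₂₃]`: `(a ⊗ b, a' ⊗ b') ↦ a ⊗ a' ⊗ [b, b']`. -/
def br13_23 : T2 →ₗ[ℂ] T2 →ₗ[ℂ] T3 :=
  (TensorProduct.map₂ (TensorProduct.mk ℂ Current Current) lieB).compr₂
    (TensorProduct.assoc ℂ Current Current Current).toLinearMap

section EnvelopingAlgebra

attribute [local instance] LieRing.ofAssociativeRing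

attribute [local instance] LieAlgebra.ofAssociativeAlgebra

/-- The universal enveloping algebra. -/
abbrev UEnv : Type := UniversalEnvelopingAlgebra ℂ Current

/-- The canonical map from the Lie algebra to its universal enveloping algebra. -/
abbrev toU : Current →ₗ[ℂ] UEnv := (UniversalEnvelopingAlgebra.ι ℂ : Current →ₗ⁅ℂ⁆ UEnv)

/-- The canonical map from `ĝ ⊗ ĝ ⊗ ĝ` to the third tensor power of the enveloping algebra. -/
def toU3 : T3 →ₗ[ℂ] UEnv ⊗[ℂ] (UEnv ⊗[ℂ] UEnv) :=
  TensorProduct.map toU (TensorProduct.map toU toU)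

/-- `a ⊗ b ↦ a ⊗ b ⊗ 1`. -/
def in12 : T2 →ₗ[ℂ] UEnv ⊗[ℂ] (UEnv ⊗[ℂ] UEnv) :=
  TensorProduct.map toU ((TensorProduct.mk ℂ UEnv UEnv).flip 1 ∘ₗ toU)

/-- `a ⊗ b ↦ a ⊗ 1 ⊗ b`. -/
def in13 : T2 →ₗ[ℂ] UEnv ⊗[ℂ] (UEnv ⊗[ℂ] UEnv) :=
  TensorProduct.map toU (TensorProduct.mk ℂ UEnv UEnv 1 ∘ₗ toU)

/-- `a ⊗ b ↦ 1 ⊗ a ⊗ b`. -/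
def in23 : T2 →ₗ[ℂ] UEnv ⊗[ℂ] (UEnv ⊗[ℂ] UEnv) :=
  TensorProduct.mk ℂ UEnv (UEnv ⊗[ℂ] UEnv) 1 ∘ₗ TensorProduct.map toU toU

/-- `br12_13` is the commutator of `t₁₂` and `t'₁₃` in the enveloping algebra. -/
theorem toU3_br12_13 (t t' : T2) :
    toU3 (br12_13 t t') = in12 t * in13 t' - in13 t' * in12 t := by
  induction t using TensorProduct.induction_on with
  | zero => simp
  | add x y hx hy => simp only [map_add, LinearMap.add_apply, hx, hy, add_mul, mul_add]; abel
  | tmul a b =>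
    induction t' using TensorProduct.induction_on with
    | zero => simp
    | add x y hx hy => simp only [map_add, hx, hy, add_mul, mul_add]; abel
    | tmul a' b' =>
      simp [toU3, br12_13, in12, in13, lieB, Ring.lie_def, TensorProduct.sub_tmul]

/-- `br12_23` is the commutator of `t₁₂` and `t'₂₃` in the enveloping algebra. -/
theorem toU3_br12_23 (t t' : T2) :
    toU3 (br12_23 t t') = in12 t * in23 t' - in23 t' * in12 t := by
  induction t using TensorProduct.induction_on with
  | zero => simp
  | add x y hx hy => simp only [map_add, LinearMap.add_apply, hx, hy, add_mul, mul_add]; abel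
  | tmul a b =>
    induction t' using TensorProduct.induction_on with
    | zero => simp
    | add x y hx hy => simp only [map_add, hx, hy, add_mul, mul_add]; abel
    | tmul a' b' =>
      simp [toU3, br12_23, in12, in23, lieB, Ring.lie_def, TensorProduct.sub_tmul,
        TensorProduct.tmul_sub]

/-- `br13_23` is the commutator of `t₁₃` and `t'₂₃` in the enveloping algebra. -/
theorem toU3_br13_23 (t t' : T2) :
    toU3 (br13_23 t t') = in13 t * in23 t' - in23 t' * in13 t := by
  induction t using TensorProduct.induction_on with
  | zero => simp
  | add x y hx hy => simp only [map_add, LinearMap.add_apply, hx, hy, add_mul, mul_add]; abel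
  | tmul a b =>
    induction t' using TensorProduct.induction_on with
    | zero => simp
    | add x y hx hy => simp only [map_add, hx, hy, add_mul, mul_add]; abel
    | tmul a' b' =>
      simp [toU3, br13_23, in13, in23, lieB, Ring.lie_def, TensorProduct.tmul_sub]

end EnvelopingAlgebra

/-! ### The universal r-matrix -/

/-- Labels of the terms of the universal r-matrix: `hh n`, `ef n`, `fe n` for the `n`-th terms
(`n ∈ ℤ`) of its three series, and `cd` for the term `c ⊗ d`. -/
inductive Label : Type
  | hh (n : ℤ)
  | ef (n : ℤ)
  | fe (n : ℤ)
  | cd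

/-- `e^{2πiz}`. -/
def ex (z : ℂ) : ℂ := Complex.exp (2 * Real.pi * Complex.I * z)

/-- The terms of the universal r-matrix with modulus `τ` and dynamical parameter `lam`. -/
def rTerm (τ lam : ℂ) : Label → T2
  | .hh n => (if n = 0 then (1 / 4 : ℂ) else (1 / 2 : ℂ) * (1 / (1 - ex (n * τ)))) •
      (cur hh (jUp n) ⊗ₜ[ℂ] cur hh (jLow n))
  | .ef n => (1 / (1 - ex (n * τ + lam))) • (cur ee (jUp n) ⊗ₜ[ℂ] cur ff (jLow n))
  | .fe n => (1 / (1 - ex (n * τ - lam))) • (cur ff (jUp n) ⊗ₜ[ℂ] cur ee (jLow n))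
  | .cd => cc ⊗ₜ[ℂ] dd

/-- The admissible parameters: `Im τ > 0` and `lam ∉ ℤ + τ ℤ`. -/
def Admissible (τ lam : ℂ) : Prop :=
  0 < τ.im ∧ ∀ m n : ℤ, lam ≠ m + n * τ

/-- The element `h = ĥ[j₀]`. -/
def h0 : Current := cur hh (jLow 0)

end EllipticCurrent

end

open EllipticCurrent

/-!
The elements of `K` are trigonometric polynomials (`span_jLow`), so that any vector of the current
algebra pairs nontrivially with the tensor factors of only finitely many terms of the r-matrix
(`finite_form_fst`, `finite_form_snd`). Every series in question is therefore weakly a finite sum,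
and is differentiated term by term.

Pairing the first slot of the r-matrix with a vector turns it into an operator `R` (`opR`) on the
current algebra, diagonal in the basis formed by `c` and the second factors of the terms. Its
eigenvalue on a weight vector of weight `ζ = n τ + w lam` is `m = 1 / (1 - e^{2πiζ})`, with the
exceptional values `1/2` on `h`, `1` on `d` and `0` on `c`. Opposite weights give `m` and `1 - m`,
so that the transpose of `R` is `1 - R` (`opRT_coef`). By invariance of the scalar product, the
left-hand side of the dynamical Yang-Baxter equation, paired with eigenvectors `x`, `y`, `z` of
eigenvalues `p`, `q`, `s`, becomes `((1 - p) (1 - q) (1 - s) + p q s) ⟨x, [y, z]⟩`, and both sides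
of the equation are alternating in `x`, `y`, `z`.

The pairing `⟨x, [y, z]⟩` vanishes unless the weights add up to zero. In that case the
exponentials `P`, `Q`, `S` satisfy `P Q S = 1`, and the coefficient, which is a multiple of
`1 - P Q S`, is zero unless an exceptional vector is involved. If `x` is `h` or `d`, the pairing is the
weight of `y` times `⟨y, z⟩` up to a constant, while `s = 1 - q` makes the coefficient
`q (1 - q)`. As `∂m/∂ζ = 2πi (m² - m)`, this is the derivative of `R` with respect to `lam` or `τ` on the
right-hand side. All of this is in `dynamicalYBE`; if one of the vectors is `c`, both sides
vanish.
-/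

noncomputable section

namespace EllipticCurrent

/-! ### Trigonometric polynomials -/

open Function.Periodic in
/-- In the coordinate `q = e^{2πiu}`, an element of `K` times a high power of `q` extends to an
entire function of polynomial growth, hence is a polynomial in `q`. -/
theorem exists_trigPolynomial (s : K) : ∃ (N M : ℕ) (a : ℕ → ℂ), ∀ u : ℂ,
    (s : ℂ → ℂ) u = ∑ n ∈ Finset.range M, a n * (jLow ((n : ℤ) - N) : ℂ → ℂ) u := by
  obtain ⟨hd, h1, C, p, hC, hp, hb⟩ := s.2
  obtain ⟨N, hN⟩ := exists_nat_ge p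
  -- With `p ≤ 2πN`, the product `s j_N` is bounded as `Im u → ∞`.
  set g : ℂ → ℂ := fun u => (s : ℂ → ℂ) u * (jLow N : ℂ → ℂ) u with hg
  have hgd : Differentiable ℂ g := hd.mul (K_differentiable (jLow N))
  have hgp : Function.Periodic g ((1 : ℝ) : ℂ) := fun u => by
    simp only [hg, Complex.ofReal_one, h1, (jLow N).2.2.1 u]
  have hjn : ∀ (n : ℤ) (u : ℂ), (jLow n : ℂ → ℂ) u = qParam 1 u ^ n := fun n u => by
    rw [qParam, ← Complex.exp_int_mul]
    change Complex.exp _ = _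
    congr 1
    push_cast
    ring
  have hq : ∀ u : ℂ, ‖qParam 1 u‖ = Real.exp (-(2 * Real.pi * u.im)) := fun u => by
    rw [norm_qParam]; congr 1; ring
  have hpi : (1 : ℝ) ≤ 2 * Real.pi := by linarith [Real.pi_gt_three]
  have hpN : p ≤ 2 * Real.pi * N := by nlinarith [(Nat.cast_nonneg N : (0 : ℝ) ≤ N)]
  have hgb : ∀ u, ‖g u‖ ≤ C * max 1 (‖qParam 1 u‖ ^ (2 * N)) := fun u => by
    have h2 : ‖(jLow N : ℂ → ℂ) u‖ = Real.exp (-(2 * Real.pi * N * u.im)) := by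
      rw [hjn, zpow_natCast, norm_pow, hq, ← Real.exp_nat_mul]; congr 1; ring
    rw [hg, norm_mul, h2]
    refine (mul_le_mul_of_nonneg_right (hb u) (Real.exp_nonneg _)).trans ?_
    rw [mul_assoc, ← Real.exp_add]
    refine mul_le_mul_of_nonneg_left ?_ hC.le
    rcases le_total 0 u.im with h | h
    · refine le_max_of_le_left (Real.exp_le_one_iff.mpr ?_)
      rw [abs_of_nonneg h]
      nlinarith
    · refine le_max_of_le_right ?_
      rw [hq, ← Real.exp_nat_mul, abs_of_nonpos h]
      apply Real.exp_le_exp.mpr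
      push_cast
      nlinarith
  set G := cuspFunction 1 g with hG
  have hGg : ∀ u, G (qParam 1 u) = g u := eq_cuspFunction one_ne_zero hgp
  have hGd : Differentiable ℂ G := fun q => by
    by_cases h : q = 0
    · rw [h]
      refine differentiableAt_cuspFunction_zero one_pos hgp (.of_forall fun z => hgd z) ?_
      refine Asymptotics.IsBigO.of_bound C ?_
      have : ∀ᶠ u : ℂ in Filter.comap Complex.im Filter.atTop, 0 ≤ u.im :=
        Filter.tendsto_comap.eventually (Filter.eventually_ge_atTop 0)
      filter_upwards [this] with u hu
      refine (hgb u).trans ?_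
      rw [max_eq_left]
      · simp
      · refine pow_le_one₀ (norm_nonneg _) ?_
        rw [hq]
        exact Real.exp_le_one_iff.mpr (by nlinarith)
    · rw [← qParam_right_inv one_ne_zero h]
      exact differentiableAt_cuspFunction one_ne_zero hgp (hgd _)
  have hGb : ∀ q, q ≠ 0 → ‖G q‖ ≤ C * max 1 (‖q‖ ^ (2 * N)) := fun q h => by
    have h2 := hgb (invQParam 1 q)
    rwa [← hGg, qParam_right_inv one_ne_zero h] at h2
  -- Cauchy's estimates on circles of radius `R → ∞`.
  have hder : ∀ n, 2 * N < n → iteratedDeriv n G 0 = 0 := fun n hn => by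
    have hle : ∀ R : ℝ, 1 ≤ R → ‖iteratedDeriv n G 0‖ ≤ n.factorial * C * R⁻¹ := fun R hR => by
      have hR0 : 0 < R := by linarith
      have := Complex.norm_iteratedDeriv_le_of_forall_mem_sphere_norm_le (c := 0) (R := R)
        (C := C * R ^ (2 * N)) n hR0 hGd.diffContOnCl (fun z hz => by
          have hz : ‖z‖ = R := by simpa using hz
          have h2 := hGb z (norm_pos_iff.mp (by rw [hz]; exact hR0))
          rwa [hz, max_eq_right (one_le_pow₀ hR)] at h2)
      refine this.trans ?_
      rw [div_le_iff₀ (by positivity)]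
      have h3 : R ^ (2 * N) ≤ R⁻¹ * R ^ n := by
        obtain ⟨m, rfl⟩ : ∃ m, n = m + 1 := ⟨n - 1, by omega⟩
        rw [pow_succ', inv_mul_cancel_left₀ hR0.ne']
        exact pow_le_pow_right₀ hR (by omega)
      calc (n.factorial : ℝ) * (C * R ^ (2 * N)) = n.factorial * C * R ^ (2 * N) := by ring
        _ ≤ n.factorial * C * (R⁻¹ * R ^ n) := by gcongr
        _ = _ := by ring
    have hlim : Filter.Tendsto (fun R : ℝ => n.factorial * C * R⁻¹) Filter.atTop (nhds 0) := by
      simpa using (tendsto_inv_atTop_zero (𝕜 := ℝ)).const_mul (n.factorial * C)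
    have := ge_of_tendsto hlim ((Filter.eventually_ge_atTop 1).mono hle)
    exact norm_le_zero_iff.mp this
  refine ⟨N, 2 * N + 1, fun n => (n.factorial : ℂ)⁻¹ * iteratedDeriv n G 0, fun u => ?_⟩
  have hT := Complex.taylorSeries_eq_of_entire hGd 0 (qParam 1 u)
  rw [tsum_eq_sum (s := Finset.range (2 * N + 1)) (fun n hn => by
    rw [hder n (by simpa using hn)]; simp), hGg] at hT
  have hne : qParam 1 u ≠ 0 := qParam_ne_zero u
  have hs : (s : ℂ → ℂ) u = g u * qParam 1 u ^ (-(N : ℤ)) := by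
    rw [hg]
    simp only [hjn]
    rw [mul_assoc, ← zpow_add₀ hne]; simp
  rw [hs, ← hT, Finset.sum_mul]
  refine Finset.sum_congr rfl fun n _ => ?_
  rw [hjn, zpow_sub₀ hne, zpow_neg, zpow_natCast]
  simp only [sub_zero, smul_eq_mul, zpow_natCast]
  ring

/-- `K` consists of the trigonometric polynomials. -/
theorem span_jLow : Submodule.span ℂ (Set.range jLow) = ⊤ := by
  refine eq_top_iff.mpr fun s _ => ?_
  obtain ⟨N, M, a, h⟩ := exists_trigPolynomial s
  have hs : s = ∑ n ∈ Finset.range M, a n • jLow ((n : ℤ) - N) := by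
    refine Subtype.ext (funext fun u => ?_)
    rw [h]
    simp [Finset.sum_apply]
  rw [hs]
  exact Submodule.sum_mem _ fun n _ => Submodule.smul_mem _ _ (Submodule.subset_span ⟨_, rfl⟩)

theorem jLow_mul (m n : ℤ) : jLow m * jLow n = jLow (m + n) := by
  refine Subtype.ext (funext fun u => ?_)
  change Complex.exp _ * Complex.exp _ = Complex.exp _
  rw [← Complex.exp_add]
  congr 1
  push_cast
  ring

theorem derivK_jLow (n : ℤ) : derivK (jLow n) = (2 * Real.pi * Complex.I * n : ℂ) • jLow n := by
  refine Subtype.ext (funext fun u => ?_)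
  have h := ((hasDerivAt_id u).const_mul (2 * Real.pi * Complex.I * n : ℂ)).cexp
  change deriv (fun u => Complex.exp (2 * Real.pi * Complex.I * n * u)) u
    = 2 * Real.pi * Complex.I * n * Complex.exp (2 * Real.pi * Complex.I * n * u)
  simp only [id_eq] at h
  rw [h.deriv]
  ring

theorem formK_jLow (m n : ℤ) : formK (jLow m) (jLow n)
    = if m + n = 0 then (2 * Real.pi * Complex.I : ℂ)⁻¹ else 0 := by
  split_ifs with h
  · have : ∀ x : ℝ, (jLow m : ℂ → ℂ) x * (jLow n : ℂ → ℂ) x = 1 := fun x => by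
      have h2 : (jLow m * jLow n : ℂ → ℂ) x = (jLow (m + n) : ℂ → ℂ) x := by rw [← jLow_mul]; rfl
      rw [← Pi.mul_apply, h2, h]
      change Complex.exp _ = 1
      simp
    rw [formK_apply]
    simp only [this]
    norm_num
  · -- The derivation is skew and `j_m`, `j_n` are eigenvectors, so that `(m + n) ⟨j_m, j_n⟩ = 0`.
    have h2 := formK_deriv (jLow m) (jLow n)
    rw [derivK_jLow, derivK_jLow, map_smul, map_smul, LinearMap.smul_apply, smul_eq_mul,
      smul_eq_mul] at h2
    have h3 : (2 * Real.pi * Complex.I : ℂ) * ((m : ℂ) + n) * formK (jLow m) (jLow n) = 0 := by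
      linear_combination h2
    have h4 : (m : ℂ) + n ≠ 0 := by exact_mod_cast h
    simpa [h4] using h3

theorem formK_jUp_jLow (m n : ℤ) : formK (jUp m) (jLow n) = if m = n then 1 else 0 := by
  rw [jUp, map_smul, LinearMap.smul_apply, formK_jLow]
  by_cases h : m = n
  · rw [if_pos (by omega), if_pos h, smul_eq_mul, mul_inv_cancel₀ Complex.two_pi_I_ne_zero]
  · rw [if_neg (by omega), if_neg h, smul_zero]

/-! ### The current algebra in a basis of weight vectors -/

theorem form_mk (X Y : Loop) (a b a' b' : ℂ) :
    Current.form (Current.mk X a b) (Current.mk Y a' b') = loopForm X Y + a * b' + b * a' := rfl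

theorem form_comm (x y : Current) : Current.form x y = Current.form y x := by
  obtain ⟨X, a, b⟩ := x
  obtain ⟨Y, a', b'⟩ := y
  change loopForm X Y + a * b' + b * a' = loopForm Y X + a' * b + b' * a
  rw [loopForm_comm]
  ring

/-- The scalar product of the current algebra is invariant. -/
theorem form_lie (x y z : Current) : Current.form ⁅x, y⁆ z = Current.form x ⁅y, z⁆ := by
  obtain ⟨X, a, b⟩ := x
  obtain ⟨Y, a', b'⟩ := y
  obtain ⟨Z, a'', b''⟩ := z
  change loopForm (⁅X, Y⁆ + b • loopDeriv Y - b' • loopDeriv X) Z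
      + loopForm (loopDeriv X) Y * b'' + 0 * a''
    = loopForm X (⁅Y, Z⁆ + b' • loopDeriv Z - b'' • loopDeriv Y) + a * 0
      + b * loopForm (loopDeriv Y) Z
  simp only [map_add, map_sub, map_smul, LinearMap.add_apply, LinearMap.sub_apply,
    LinearMap.smul_apply, smul_eq_mul, loopForm_lie, loopForm_deriv X]
  ring

theorem form_cur (x y : sl2) (s t : K) :
    Current.form (cur x s) (cur y t) = formK s t * formA x y := by
  simp [cur, form_mk, loopForm_tmul]

theorem form_cur_cc (x : sl2) (s : K) : Current.form (cur x s) cc = 0 := by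
  simp [cur, cc, form_mk]

theorem form_cc_cur (x : sl2) (s : K) : Current.form cc (cur x s) = 0 := by
  simp [cur, cc, form_mk]

theorem form_cur_dd (x : sl2) (s : K) : Current.form (cur x s) dd = 0 := by
  simp [cur, dd, form_mk]

theorem form_cc_cc : Current.form cc cc = 0 := by simp [cc, form_mk]

theorem form_dd_dd : Current.form dd dd = 0 := by simp [dd, form_mk]

theorem form_cc_dd : Current.form cc dd = 1 := by simp [cc, dd, form_mk]

theorem form_dd_cc : Current.form dd cc = 1 := by simp [cc, dd, form_mk]

theorem formA_hh_hh : formA hh hh = 2 := by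
  simp [formA_apply, hh, Matrix.trace_fin_two]; norm_num

theorem formA_hh_ee : formA hh ee = 0 := by simp [formA_apply, hh, ee, Matrix.trace_fin_two]

theorem formA_hh_ff : formA hh ff = 0 := by simp [formA_apply, hh, ff, Matrix.trace_fin_two]

theorem formA_ee_ee : formA ee ee = 0 := by simp [formA_apply, ee, Matrix.trace_fin_two]

theorem formA_ff_ff : formA ff ff = 0 := by simp [formA_apply, ff, Matrix.trace_fin_two]

theorem formA_ee_ff : formA ee ff = 1 := by simp [formA_apply, ff, ee, Matrix.trace_fin_two]

theorem lie_hh_ee : ⁅hh, ee⁆ = (2 : ℂ) • ee := by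
  refine Subtype.ext ?_
  change hh.1 * ee.1 - ee.1 * hh.1 = _
  ext i j
  fin_cases i <;> fin_cases j <;> simp [hh, ee]
  norm_num

theorem lie_hh_ff : ⁅hh, ff⁆ = (-2 : ℂ) • ff := by
  refine Subtype.ext ?_
  change hh.1 * ff.1 - ff.1 * hh.1 = _
  ext i j
  fin_cases i <;> fin_cases j <;> simp [hh, ff]
  norm_num

theorem span_sl2 : Submodule.span ℂ {hh, ee, ff} = ⊤ := by
  refine eq_top_iff.mpr fun x _ => ?_
  have htr : Matrix.trace x.1 = 0 := x.2
  rw [Matrix.trace_fin_two] at htr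
  have hx : x = x.1 0 0 • hh + (x.1 0 1 • ee + x.1 1 0 • ff) := by
    refine Subtype.ext ?_
    ext i j
    fin_cases i <;> fin_cases j <;> simp [hh, ee, ff]
    linear_combination htr
  rw [hx]
  refine add_mem ?_ (add_mem ?_ ?_) <;>
    exact Submodule.smul_mem _ _ (Submodule.subset_span (by simp))

/-- The first tensor factors of the terms of the universal r-matrix. -/
def fstFactor : Label → Current
  | .hh n => cur hh (jUp n)
  | .ef n => cur ee (jUp n)
  | .fe n => cur ff (jUp n)
  | .cd => cc

/-- The second tensor factors of the terms of the universal r-matrix. Together with `c` they form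
a basis of the current algebra, which is dual to the first factors up to normalization. -/
def sndFactor : Label → Current
  | .hh n => cur hh (jLow n)
  | .ef n => cur ff (jLow n)
  | .fe n => cur ee (jLow n)
  | .cd => dd

/-- The square length of the `sl₂`-part of a factor. -/
def sqLength : Label → ℂ
  | .hh _ => 2
  | _ => 1

/-- The label with the opposite weight. -/
def opp : Label → Label
  | .hh n => .hh (-n)
  | .ef n => .fe (-n)
  | .fe n => .ef (-n)
  | .cd => .cd

/-- The degree of `sndFactor i` with respect to `d / 2πi`. -/
def deg : Label → ℤ
  | .hh n => n
  | .ef n => n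
  | .fe n => n
  | .cd => 0

/-- The weight of `sndFactor i` with respect to `-h / 2`; with this sign it is the coefficient of
the dynamical parameter in the `i`-th term of the universal r-matrix. -/
def wt : Label → ℤ
  | .hh _ => 0
  | .ef _ => 1
  | .fe _ => -1
  | .cd => 0

/-- An additive predicate on the current algebra that holds on the weight basis holds
everywhere. -/
theorem current_induction {P : Current → Prop} (hadd : ∀ x y, P x → P y → P (x + y))
    (hsmul : ∀ (a : ℂ) x, P x → P (a • x)) (hs : ∀ i, P (sndFactor i)) (hc : P cc)
    (v : Current) : P v := by
  have h0 : P 0 := by simpa using hsmul 0 _ hc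
  have hL : ∀ X : Loop, P (Current.mk X 0 0) := fun X => by
    have ha : ∀ X Y : Loop, P (Current.mk X 0 0) → P (Current.mk Y 0 0) →
        P (Current.mk (X + Y) 0 0) := fun X Y hX hY => by
      have : Current.mk (X + Y) 0 0 = Current.mk X 0 0 + Current.mk Y 0 0 := by
        ext <;> simp
      rw [this]; exact hadd _ _ hX hY
    have hm : ∀ (a : ℂ) (X : Loop), P (Current.mk X 0 0) →
        P (Current.mk (a • X) 0 0) := fun a X hX => by
      have : Current.mk (a • X) 0 0 = a • Current.mk X 0 0 := by ext <;> simp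
      rw [this]; exact hsmul _ _ hX
    induction X using TensorProduct.induction_on with
    | zero => exact h0
    | add X Y hX hY => exact ha _ _ hX hY
    | tmul s x =>
      have hs' : s ∈ Submodule.span ℂ (Set.range jLow) := span_jLow ▸ Submodule.mem_top
      induction hs' using Submodule.span_induction with
      | zero => rw [TensorProduct.zero_tmul]; exact h0
      | add s t _ _ h h' => rw [TensorProduct.add_tmul]; exact ha _ _ h h'
      | smul a s _ h => rw [← TensorProduct.smul_tmul']; exact hm _ _ h
      | mem s h =>
        obtain ⟨n, rfl⟩ := h
        have hx : x ∈ Submodule.span ℂ {hh, ee, ff} := span_sl2 ▸ Submodule.mem_top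
        induction hx using Submodule.span_induction with
        | zero => rw [TensorProduct.tmul_zero]; exact h0
        | add s t _ _ h h' => rw [TensorProduct.tmul_add]; exact ha _ _ h h'
        | smul a s _ h => rw [TensorProduct.tmul_smul]; exact hm _ _ h
        | mem x h =>
          rcases h with rfl | rfl | rfl
          · exact hs (.hh n)
          · exact hs (.fe n)
          · exact hs (.ef n)
  have hv : v = Current.mk v.loop 0 0 + (v.cen • cc + v.coc • dd) := by
    ext <;> simp [cc, dd]
  rw [hv]
  exact hadd _ _ (hL _) (hadd _ _ (hsmul _ _ hc) (hsmul _ _ (hs .cd)))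

theorem form_fst_snd (i j : Label) [Decidable (i = j)] :
    Current.form (fstFactor i) (sndFactor j) = if i = j then sqLength i else 0 := by
  cases i <;> cases j <;>
    simp [fstFactor, sndFactor, form_cur, formK_jUp_jLow, form_cur_dd, form_cc_cur, form_cc_dd,
      sqLength, formA_hh_hh, formA_hh_ee, formA_hh_ff, formA_ee_ee, formA_ff_ff, formA_ee_ff,
      formA_comm ee hh, formA_comm ff hh, formA_comm ff ee]

theorem form_fst_cc (i : Label) : Current.form (fstFactor i) cc = 0 := by
  cases i <;> simp [fstFactor, form_cur_cc, form_cc_cc]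

theorem form_snd_cc (i : Label) [Decidable (i = .cd)] :
    Current.form (sndFactor i) cc = if i = .cd then 1 else 0 := by
  cases i <;> simp [sndFactor, form_cur_cc, form_dd_cc]

theorem form_snd_dd (i : Label) : Current.form (sndFactor i) dd = 0 := by
  cases i <;> simp [sndFactor, form_cur_dd, form_dd_dd]

theorem cur_smul (x : sl2) (a : ℂ) (s : K) : cur x (a • s) = a • cur x s := by
  ext <;> simp [cur, TensorProduct.smul_tmul']

theorem opp_opp (i : Label) : opp (opp i) = i := by cases i <;> simp [opp]

theorem sqLength_opp (i : Label) : sqLength (opp i) = sqLength i := by cases i <;> rfl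

theorem fstFactor_eq {i : Label} (hi : i ≠ .cd) :
    fstFactor i = (2 * Real.pi * Complex.I : ℂ) • sndFactor (opp i) := by
  cases i <;> first | exact absurd rfl hi | exact cur_smul _ _ _

theorem lie_cur (x y : sl2) (s t : K) : ⁅cur x s, cur y t⁆
    = Current.mk ((s * t) ⊗ₜ ⁅x, y⁆) (formK (derivK s) t * formA x y) 0 := by
  simp [cur, Current.lie_def, LieAlgebra.ExtendScalars.bracket_tmul, loopDeriv_tmul,
    loopForm_tmul]

theorem lie_cc (x : Current) : ⁅x, cc⁆ = 0 := by
  ext <;> simp [cc, Current.lie_def]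

theorem cc_lie (x : Current) : ⁅cc, x⁆ = 0 := by
  rw [← lie_skew, lie_cc, neg_zero]

theorem dd_lie_snd (i : Label) :
    ⁅dd, sndFactor i⁆ = (2 * Real.pi * Complex.I * deg i : ℂ) • sndFactor i := by
  have h : ∀ x n, ⁅dd, cur x (jLow n)⁆ = (2 * Real.pi * Complex.I * n : ℂ) • cur x (jLow n) :=
    fun x n => by
      ext <;> simp [dd, cur, Current.lie_def, loopDeriv_tmul, derivK_jLow,
        TensorProduct.smul_tmul']
  cases i
  · exact h _ _
  · exact h _ _
  · exact h _ _
  · simp [sndFactor, deg]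

theorem h0_lie_snd (i : Label) : ⁅h0, sndFactor i⁆ = (-2 * wt i : ℂ) • sndFactor i := by
  have h : ∀ x n, ⁅h0, cur x (jLow n)⁆ = Current.mk (jLow n ⊗ₜ ⁅hh, x⁆) 0 0 := fun x n => by
    rw [h0, lie_cur, jLow_mul, zero_add, derivK_jLow]
    simp
  have h' : ∀ x n (a : ℂ), Current.mk (jLow n ⊗ₜ (a • x)) 0 0 = a • cur x (jLow n) :=
    fun x n a => by ext <;> simp [cur]
  cases i with
  | hh n => simp [sndFactor, h, wt, Current.mk]; rfl
  | ef n => rw [sndFactor, h, lie_hh_ff, h']; simp [wt]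
  | fe n => rw [sndFactor, h, lie_hh_ee, h']; simp [wt]
  | cd =>
    have : loopDeriv (jLow 0 ⊗ₜ hh) = 0 := by simp [loopDeriv_tmul, derivK_jLow]
    ext <;> simp [sndFactor, wt, h0, dd, cur, Current.lie_def, this]

theorem sqLength_ne_zero (i : Label) : sqLength i ≠ 0 := by cases i <;> simp [sqLength]

theorem deg_opp (i : Label) : deg (opp i) = -deg i := by cases i <;> simp [opp, deg]

theorem wt_opp (i : Label) : wt (opp i) = -wt i := by cases i <;> simp [opp, wt]

theorem form_snd_snd {i : Label} (hi : i ≠ .cd) (j : Label) [Decidable (opp i = j)] :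
    Current.form (sndFactor i) (sndFactor j)
      = if opp i = j then (2 * Real.pi * Complex.I : ℂ)⁻¹ * sqLength i else 0 := by
  have hi' : opp i ≠ .cd := by cases i <;> simp_all [opp]
  have h := form_fst_snd (opp i) j
  rw [fstFactor_eq hi', opp_opp, map_smul, LinearMap.smul_apply, smul_eq_mul, sqLength_opp] at h
  rw [(eq_inv_mul_iff_mul_eq₀ Complex.two_pi_I_ne_zero).mpr h]
  split_ifs
  · rfl
  · exact mul_zero _

/-- Only opposite weight vectors of the loop algebra pair nontrivially. -/
theorem eq_opp_of_form_snd_ne_zero {i j : Label}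
    (h : Current.form (sndFactor i) (sndFactor j) ≠ 0) : i ≠ .cd ∧ j = opp i := by
  classical
  by_cases hi : i = .cd
  · subst hi
    exact absurd (by rw [form_comm]; exact form_snd_dd j) h
  · rw [form_snd_snd hi] at h
    exact ⟨hi, by by_contra h'; exact h (if_neg (Ne.symm h'))⟩

/-! ### Contraction against diagonal tensors -/

theorem finite_support_of_basis (a : Label → Current)
    (hs : ∀ j, {i | Current.form (a i) (sndFactor j) ≠ 0}.Finite)
    (hc : {i | Current.form (a i) cc ≠ 0}.Finite) (v : Current) :
    {i | Current.form (a i) v ≠ 0}.Finite := by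
  refine current_induction (P := fun v => {i | Current.form (a i) v ≠ 0}.Finite)
    (fun x y hx hy => (hx.union hy).subset fun i hi => ?_)
    (fun r x hx => hx.subset fun i hi => ?_) hs hc v
  · by_contra h
    simp only [Set.mem_union, Set.mem_ofPred_eq, not_or, not_not] at h
    exact hi (by rw [map_add, h.1, h.2, add_zero])
  · intro h
    exact hi (by rw [map_smul, h, smul_zero])

theorem finite_form_fst (v : Current) : {i | Current.form (fstFactor i) v ≠ 0}.Finite := by
  classical
  refine finite_support_of_basis _ (fun j => (Set.finite_singleton j).subset fun i hi => ?_)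
    (Set.finite_empty.subset fun i hi => hi (form_fst_cc i)) v
  by_contra h
  exact hi (by rw [form_fst_snd]; exact if_neg h)

theorem finite_form_snd (v : Current) : {i | Current.form (sndFactor i) v ≠ 0}.Finite := by
  classical
  refine finite_support_of_basis _
    (fun j => (Set.finite_singleton (opp j)).subset fun i hi => ?_)
    ((Set.finite_singleton .cd).subset fun i hi => ?_) v
  · rw [Set.mem_singleton_iff, (eq_opp_of_form_snd_ne_zero hi).2, opp_opp]
  · by_contra h
    exact hi (by rw [form_snd_cc]; exact if_neg h)

/-- The operator `v ↦ ∑ i, κ i ⟨a i, v⟩ b i`, given by the partial pairing with the first slot of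
`∑ i, κ i (a i ⊗ b i)`; the sum is finite for each `v`. -/
def contract (a b : Label → Current) (ha : ∀ v, {i | Current.form (a i) v ≠ 0}.Finite)
    (κ : Label → ℂ) : Current →ₗ[ℂ] Current where
  toFun v := ∑ᶠ i, (κ i * Current.form (a i) v) • b i
  map_add' v w := by
    rw [← finsum_add_distrib]
    · exact finsum_congr fun i => by rw [map_add, mul_add, add_smul]
    · exact (ha v).subset fun i hi h => hi (by simp only [h, mul_zero, zero_smul])
    · exact (ha w).subset fun i hi h => hi (by simp only [h, mul_zero, zero_smul])
  map_smul' r v := by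
    rw [RingHom.id_apply, smul_finsum]
    exact finsum_congr fun i => by rw [map_smul, smul_smul, smul_eq_mul]; congr 1; ring

theorem contract_eq_sum (a b : Label → Current) (ha : ∀ v, {i | Current.form (a i) v ≠ 0}.Finite)
    (κ : Label → ℂ) (v : Current) :
    contract a b ha κ v = ∑ i ∈ (ha v).toFinset, (κ i * Current.form (a i) v) • b i :=
  finsum_eq_sum_of_support_subset _ fun i hi => by
    simp only [Set.Finite.coe_toFinset, Set.mem_ofPred_eq]
    exact fun h => hi (by simp only [h, mul_zero, zero_smul])

theorem contract_eq_single (a b : Label → Current)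
    (ha : ∀ v, {i | Current.form (a i) v ≠ 0}.Finite) (κ : Label → ℂ) (v : Current) (j : Label)
    (h : ∀ i, i ≠ j → Current.form (a i) v = 0) :
    contract a b ha κ v = (κ j * Current.form (a j) v) • b j :=
  finsum_eq_single _ j fun i hi => by rw [h i hi, mul_zero, zero_smul]

theorem hasSum_contract (a b : Label → Current)
    (ha : ∀ v, {i | Current.form (a i) v ≠ 0}.Finite) (κ : Label → ℂ) (v : Current)
    (g : Current →ₗ[ℂ] ℂ) :
    HasSum (fun i => κ i * Current.form (a i) v * g (b i)) (g (contract a b ha κ v)) := by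
  rw [contract_eq_sum, map_sum]
  simp only [map_smul, smul_eq_mul]
  refine hasSum_sum_of_ne_finset_zero fun i hi => ?_
  rw [not_not.mp (mt (ha v).mem_toFinset.mpr hi), mul_zero, zero_mul]

theorem hasSum_contract₂ (a b a' b' : Label → Current)
    (ha : ∀ v, {i | Current.form (a i) v ≠ 0}.Finite)
    (ha' : ∀ v, {i | Current.form (a' i) v ≠ 0}.Finite) (κ κ' : Label → ℂ) (v w : Current)
    (g : Current →ₗ[ℂ] Current →ₗ[ℂ] ℂ) :
    HasSum (fun p : Label × Label => κ p.1 * Current.form (a p.1) v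
      * (κ' p.2 * Current.form (a' p.2) w) * g (b p.1) (b' p.2))
      (g (contract a b ha κ v) (contract a' b' ha' κ' w)) := by
  have h : g (contract a b ha κ v) (contract a' b' ha' κ' w)
      = ∑ p ∈ (ha v).toFinset ×ˢ (ha' w).toFinset, κ p.1 * Current.form (a p.1) v
        * (κ' p.2 * Current.form (a' p.2) w) * g (b p.1) (b' p.2) := by
    rw [contract_eq_sum _ _ ha, contract_eq_sum _ _ ha', Finset.sum_product,
      LinearMap.map_sum₂]
    refine Finset.sum_congr rfl fun i _ => ?_
    rw [map_sum]
    refine Finset.sum_congr rfl fun j _ => ?_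
    simp only [map_smul, LinearMap.smul_apply, smul_eq_mul]
    ring
  rw [h]
  refine hasSum_sum_of_ne_finset_zero fun p hp => ?_
  rw [Finset.mem_product, Set.Finite.mem_toFinset, Set.Finite.mem_toFinset, not_and_or] at hp
  rcases hp with hp | hp
  · rw [not_not.mp hp]; ring
  · rw [not_not.mp hp]; ring

/-- The operator `v ↦ ∑ i, κ i ⟨a i, v⟩ b i` where `a i`, `b i` are the first and second factors
of the terms of the universal r-matrix. -/
def opR (κ : Label → ℂ) : Current →ₗ[ℂ] Current :=
  contract fstFactor sndFactor finite_form_fst κ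

/-- The transpose `v ↦ ∑ i, κ i ⟨b i, v⟩ a i` of `opR κ`. -/
def opRT (κ : Label → ℂ) : Current →ₗ[ℂ] Current :=
  contract sndFactor fstFactor finite_form_snd κ

theorem opR_snd (κ : Label → ℂ) (i : Label) :
    opR κ (sndFactor i) = (sqLength i * κ i) • sndFactor i := by
  classical
  rw [opR, contract_eq_single _ _ _ _ _ i fun j hj => by rw [form_fst_snd, if_neg hj],
    form_fst_snd, if_pos rfl, mul_comm]

theorem opR_cc (κ : Label → ℂ) : opR κ cc = 0 := by
  rw [opR, contract_eq_single _ _ _ _ _ .cd fun i _ => form_fst_cc i, form_fst_cc, mul_zero,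
    zero_smul]

theorem opRT_snd (κ : Label → ℂ) {i : Label} (hi : i ≠ .cd) :
    opRT κ (sndFactor i) = (sqLength i * κ (opp i)) • sndFactor i := by
  classical
  have hi' : opp i ≠ .cd := by cases i <;> simp_all [opp]
  rw [opRT, contract_eq_single _ _ _ _ _ (opp i) fun j hj => ?_,
    form_snd_snd hi', if_pos (opp_opp i), fstFactor_eq hi', smul_smul, opp_opp, sqLength_opp]
  · congr 1
    field_simp [Complex.two_pi_I_ne_zero]
  · by_contra h
    exact hj (by rw [(eq_opp_of_form_snd_ne_zero h).2, opp_opp])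

theorem opRT_dd (κ : Label → ℂ) : opRT κ dd = 0 := by
  rw [opRT, contract_eq_single _ _ _ _ _ .cd fun i _ => form_snd_dd i, form_snd_dd, mul_zero,
    zero_smul]

theorem opRT_cc (κ : Label → ℂ) : opRT κ cc = κ .cd • cc := by
  classical
  rw [opRT, contract_eq_single _ _ _ _ _ .cd fun i hi => by rw [form_snd_cc, if_neg hi],
    form_snd_cc, if_pos rfl, mul_one]
  rfl

/-- The weak sum of `∑ i, κ i (a i ⊗ b i)`, where `a i`, `b i` are the first and second factors of
the terms of the universal r-matrix. -/
def diagTensor (κ : Label → ℂ) : Module.Dual ℂ T2 :=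
  TensorProduct.lift (Current.form ∘ₗ opR κ)

theorem diagTensor_tmul (κ : Label → ℂ) (x y : Current) :
    diagTensor κ (x ⊗ₜ y) = Current.form (opR κ x) y := rfl

theorem emb2_tmul (a b x y : Current) :
    emb2 (a ⊗ₜ b) (x ⊗ₜ y) = Current.form a x * Current.form b y := rfl

theorem hasSum2_of_tmul {ι : Type} {f : ι → T2} {R : Module.Dual ℂ T2}
    (h : ∀ x y, HasSum (fun i => emb2 (f i) (x ⊗ₜ y)) (R (x ⊗ₜ y))) : HasSum2 f R := fun φ => by
  induction φ using TensorProduct.induction_on with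
  | zero => simp
  | tmul x y => exact h x y
  | add φ ψ hφ hψ => simpa only [map_add] using hφ.add hψ

theorem hasSum3_of_tmul {ι : Type} {f : ι → T3} {R : Module.Dual ℂ T3}
    (h : ∀ x y z, HasSum (fun i => emb3 (f i) (x ⊗ₜ (y ⊗ₜ z))) (R (x ⊗ₜ (y ⊗ₜ z)))) :
    HasSum3 f R := fun φ => by
  induction φ using TensorProduct.induction_on with
  | zero => simp
  | add φ ψ hφ hψ => simpa only [map_add] using hφ.add hψ
  | tmul x θ =>
    induction θ using TensorProduct.induction_on with
    | zero => simp
    | tmul y z => exact h x y z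
    | add φ ψ hφ hψ => simpa only [map_add, TensorProduct.tmul_add] using hφ.add hψ

theorem hasSum2_diagTensor (κ : Label → ℂ) :
    HasSum2 (fun i => κ i • (fstFactor i ⊗ₜ[ℂ] sndFactor i)) (diagTensor κ) :=
  hasSum2_of_tmul fun x y => by
    have h := hasSum_contract fstFactor sndFactor finite_form_fst κ x (Current.form.flip y)
    simp only [map_smul, LinearMap.smul_apply, emb2_tmul, smul_eq_mul, ← mul_assoc]
    exact h

/-- Pairing with an element of the tensor square involves finitely many terms, so that diagonal
tensors are differentiated termwise. -/
theorem hasDeriv2_diagTensor {κ : ℂ → Label → ℂ} {κ' : Label → ℂ} {z : ℂ}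
    (h : ∀ i, HasDerivAt (fun w => κ w i) (κ' i) z) :
    HasDeriv2 (fun w => diagTensor (κ w)) (diagTensor κ') z := fun φ => by
  induction φ using TensorProduct.induction_on with
  | zero => simpa using hasDerivAt_const z (0 : ℂ)
  | add φ ψ hφ hψ => simpa only [map_add] using hφ.fun_add hψ
  | tmul x y =>
    simp only [diagTensor_tmul, opR, contract_eq_sum, map_sum, LinearMap.sum_apply, map_smul,
      LinearMap.smul_apply, smul_eq_mul]
    exact HasDerivAt.fun_sum fun i _ => ((h i).mul_const _).mul_const _

/-- The functional `x ⊗ y ⊗ z ↦ ⟨x, [X y, Y z]⟩` of two operators `X`, `Y`. -/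
def bracketDual (X Y : Current →ₗ[ℂ] Current) : Module.Dual ℂ T3 :=
  TensorProduct.lift (Current.form.compl₂ (TensorProduct.lift (lieB.compl₁₂ X Y)))

theorem hasSum3_br12_13 (κ : Label → ℂ) :
    HasSum3 (fun p : Label × Label => br12_13 (κ p.1 • (fstFactor p.1 ⊗ₜ sndFactor p.1))
      (κ p.2 • (fstFactor p.2 ⊗ₜ sndFactor p.2))) (bracketDual (opRT κ) (opRT κ)) :=
  hasSum3_of_tmul fun x y z => by
    have h := hasSum_contract₂ _ fstFactor _ fstFactor finite_form_snd finite_form_snd κ κ y z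
      (lieB.compr₂ (Current.form x) : Current →ₗ[ℂ] Current →ₗ[ℂ] ℂ)
    convert h using 2 with p
    · simp only [map_smul, LinearMap.smul_apply, smul_eq_mul]
      change κ p.2 * (κ p.1 * (Current.form ⁅fstFactor p.1, fstFactor p.2⁆ x
        * (Current.form (sndFactor p.1) y * Current.form (sndFactor p.2) z))) = _
      rw [form_comm _ x]
      change _ = _ * Current.form x ⁅fstFactor p.1, fstFactor p.2⁆
      ring
    · rfl

theorem hasSum3_br12_23 (κ : Label → ℂ) :
    HasSum3 (fun p : Label × Label => br12_23 (κ p.1 • (fstFactor p.1 ⊗ₜ sndFactor p.1))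
      (κ p.2 • (fstFactor p.2 ⊗ₜ sndFactor p.2))) (bracketDual (opR κ) (opRT κ) ∘ₗ
        (TensorProduct.leftComm ℂ Current Current Current).toLinearMap) :=
  hasSum3_of_tmul fun x y z => by
    have h := hasSum_contract₂ _ sndFactor _ fstFactor finite_form_fst finite_form_snd κ κ x z
      (lieB.compr₂ (Current.form y) : Current →ₗ[ℂ] Current →ₗ[ℂ] ℂ)
    convert h using 2 with p
    · simp only [map_smul, LinearMap.smul_apply, smul_eq_mul]
      change κ p.2 * (κ p.1 * (Current.form (fstFactor p.1) x
        * (Current.form ⁅sndFactor p.1, fstFactor p.2⁆ y * Current.form (sndFactor p.2) z))) = _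
      rw [form_comm _ y]
      change _ = _ * Current.form y ⁅sndFactor p.1, fstFactor p.2⁆
      ring
    · rfl

theorem hasSum3_br13_23 (κ : Label → ℂ) :
    HasSum3 (fun p : Label × Label => br13_23 (κ p.1 • (fstFactor p.1 ⊗ₜ sndFactor p.1))
      (κ p.2 • (fstFactor p.2 ⊗ₜ sndFactor p.2))) (bracketDual (opR κ) (opR κ) ∘ₗ
        (TensorProduct.comm ℂ T2 Current).toLinearMap ∘ₗ
          (TensorProduct.assoc ℂ Current Current Current).symm.toLinearMap) :=
  hasSum3_of_tmul fun x y z => by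
    have h := hasSum_contract₂ _ sndFactor _ sndFactor finite_form_fst finite_form_fst κ κ x y
      (lieB.compr₂ (Current.form z) : Current →ₗ[ℂ] Current →ₗ[ℂ] ℂ)
    convert h using 2 with p
    · simp only [map_smul, LinearMap.smul_apply, smul_eq_mul]
      change κ p.2 * (κ p.1 * (Current.form (fstFactor p.1) x
        * (Current.form (fstFactor p.2) y * Current.form ⁅sndFactor p.1, sndFactor p.2⁆ z))) = _
      rw [form_comm _ z]
      change _ = _ * Current.form z ⁅sndFactor p.1, sndFactor p.2⁆
      ring
    · rfl

/-! ### The dynamical Yang-Baxter equation on weight vectors -/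

/-- The coefficients of the terms of the universal r-matrix. -/
def coef (τ lam : ℂ) : Label → ℂ
  | .hh n => if n = 0 then (1 / 4 : ℂ) else (1 / 2 : ℂ) * (1 / (1 - ex (n * τ)))
  | .ef n => 1 / (1 - ex (n * τ + lam))
  | .fe n => 1 / (1 - ex (n * τ - lam))
  | .cd => 1

theorem rTerm_eq (τ lam : ℂ) (i : Label) :
    rTerm τ lam i = coef τ lam i • (fstFactor i ⊗ₜ[ℂ] sndFactor i) := by
  cases i
  · rfl
  · rfl
  · rfl
  · exact (one_smul ℂ _).symm

/-- The eigenvalue on `sndFactor i` of the operator of the universal r-matrix. -/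
def eig (τ lam : ℂ) (i : Label) : ℂ := sqLength i * coef τ lam i

theorem ex_add (x y : ℂ) : ex (x + y) = ex x * ex y := by
  rw [ex, mul_add, Complex.exp_add]; rfl

theorem ex_zero : ex 0 = 1 := by simp [ex]

theorem ex_ne_zero (z : ℂ) : ex z ≠ 0 := Complex.exp_ne_zero _

theorem ex_neg (z : ℂ) : ex (-z) = (ex z)⁻¹ := by rw [ex, mul_neg, Complex.exp_neg]; rfl

theorem ex_eq_one_iff (z : ℂ) : ex z = 1 ↔ ∃ n : ℤ, z = n := by
  rw [ex, Complex.exp_eq_one_iff]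
  refine exists_congr fun n => ?_
  rw [mul_comm (n : ℂ), mul_right_inj' Complex.two_pi_I_ne_zero]

/-- For admissible parameters the denominators of the universal r-matrix do not vanish. -/
theorem Admissible.ex_ne_one {τ lam : ℂ} (h : Admissible τ lam) {i : Label} (hi : i ≠ .cd)
    (hi' : i ≠ .hh 0) : ex (deg i * τ + wt i * lam) ≠ 1 := by
  intro h1
  obtain ⟨m, hm⟩ := (ex_eq_one_iff _).mp h1
  cases i with
  | hh n =>
    have hn : n ≠ 0 := fun h0 => hi' (by rw [h0])
    have := congrArg Complex.im hm
    simp [deg, wt, hn, h.1.ne'] at this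
  | ef n =>
    refine h.2 m (-n) ?_
    simp only [deg, wt] at hm
    push_cast at hm ⊢
    linear_combination hm
  | fe n =>
    refine h.2 (-m) n ?_
    simp only [deg, wt] at hm
    push_cast at hm ⊢
    linear_combination -hm
  | cd => exact hi rfl

theorem eig_hh_zero (τ lam : ℂ) : eig τ lam (.hh 0) = 1 / 2 := by
  simp [eig, coef, sqLength]; norm_num

theorem eig_cd (τ lam : ℂ) : eig τ lam .cd = 1 := by
  simp [eig, coef, sqLength]

theorem eig_eq (τ lam : ℂ) {i : Label} (hi : i ≠ .cd) (hi' : i ≠ .hh 0) :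
    eig τ lam i = 1 / (1 - ex (deg i * τ + wt i * lam)) := by
  cases i with
  | hh n =>
    have hn : n ≠ 0 := fun h0 => hi' (by rw [h0])
    simp [eig, coef, sqLength, deg, wt, hn]
  | ef n => simp [eig, coef, sqLength, deg, wt]
  | fe n => simp [eig, coef, sqLength, deg, wt, sub_eq_add_neg]
  | cd => exact absurd rfl hi

theorem eig_opp {τ lam : ℂ} (h : Admissible τ lam) {i : Label} (hi : i ≠ .cd) :
    eig τ lam (opp i) = 1 - eig τ lam i := by
  by_cases hi' : i = .hh 0
  · subst hi'
    simp only [opp, neg_zero, eig_hh_zero]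
    norm_num
  · rw [eig_eq τ lam hi hi', eig_eq τ lam (by cases i <;> simp_all [opp])
      (by cases i <;> simp_all [opp]), deg_opp, wt_opp]
    have h1 : 1 - ex (deg i * τ + wt i * lam) ≠ 0 := sub_ne_zero.mpr (h.ex_ne_one hi hi').symm
    have h2 : ex (deg i * τ + wt i * lam) - 1 ≠ 0 := sub_ne_zero.mpr (h.ex_ne_one hi hi')
    have h3 := ex_ne_zero (deg i * τ + wt i * lam)
    have h4 : ((-deg i : ℤ) : ℂ) * τ + ((-wt i : ℤ) : ℂ) * lam = -(deg i * τ + wt i * lam) := by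
      push_cast; ring
    rw [h4, ex_neg]
    generalize ex (deg i * τ + wt i * lam) = X at *
    have h5 : 1 - X⁻¹ = (X - 1) / X := by field_simp
    rw [h5, one_div_div, ← neg_sub X 1, div_neg]
    field_simp
    ring

/-- The coefficients of the derivative of the universal r-matrix along a vector field on the
parameters under which the exponent of the `i`-th term has derivative `a i`. They are expressed
through the eigenvalues by `(1 / (1 - e^{2πiz}))' = 2πi (m² - m)` with `m = 1 / (1 - e^{2πiz})`. -/
def coefDeriv (τ lam : ℂ) (a : Label → ℤ) (i : Label) : ℂ :=
  2 * Real.pi * Complex.I * a i * (eig τ lam i ^ 2 - eig τ lam i) / sqLength i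

theorem hasDerivAt_one_div_one_sub_ex {g : ℂ → ℂ} {a z : ℂ} (hg : HasDerivAt g a z)
    (h : ex (g z) ≠ 1) : HasDerivAt (fun w => 1 / (1 - ex (g w)))
      (2 * Real.pi * Complex.I * a * ((1 / (1 - ex (g z))) ^ 2 - 1 / (1 - ex (g z)))) z := by
  have h1 : 1 - ex (g z) ≠ 0 := sub_ne_zero.mpr h.symm
  have h2 : HasDerivAt (fun w => 1 - ex (g w))
      (-(ex (g z) * (2 * Real.pi * Complex.I * a))) z :=
    (hg.const_mul (2 * Real.pi * Complex.I)).cexp.const_sub 1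
  simp only [one_div]
  refine (h2.fun_inv h1).congr_deriv ?_
  field_simp
  ring

theorem coef_eq (τ lam : ℂ) (i : Label) : coef τ lam i = eig τ lam i / sqLength i := by
  rw [eig, mul_div_cancel_left₀ _ (sqLength_ne_zero i)]

theorem hasDerivAt_coef {p q : ℂ → ℂ} {p' q' z : ℂ} (h : Admissible (p z) (q z))
    (hp : HasDerivAt p p' z) (hq : HasDerivAt q q' z) (i : Label) (a : Label → ℤ)
    (ha : (a i : ℂ) = deg i * p' + wt i * q') :
    HasDerivAt (fun w => coef (p w) (q w) i) (coefDeriv (p z) (q z) a i) z := by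
  have hc : ∀ x : ℂ, (fun w => eig (p w) (q w) i) = (fun _ => x) → (a i : ℂ) = 0 ∨ x ^ 2 = x →
      HasDerivAt (fun w => coef (p w) (q w) i) (coefDeriv (p z) (q z) a i) z := fun x hx h0 => by
    have h1 : (fun w => coef (p w) (q w) i) = fun _ => x / sqLength i := by
      funext w; rw [coef_eq, congrFun hx w]
    have h2 : coefDeriv (p z) (q z) a i = 0 := by
      rw [coefDeriv, congrFun hx z]
      rcases h0 with h0 | h0 <;> simp [h0]
    rw [h1, h2]
    exact hasDerivAt_const _ _
  by_cases hi : i = .cd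
  · subst hi
    exact hc 1 (funext fun w => eig_cd _ _) (.inr (by norm_num))
  by_cases hi' : i = .hh 0
  · subst hi'
    exact hc (1 / 2) (funext fun w => eig_hh_zero _ _) (.inl (by simpa [deg, wt] using ha))
  have hd := (hasDerivAt_one_div_one_sub_ex
    ((hp.const_mul (deg i : ℂ)).fun_add (hq.const_mul (wt i : ℂ))) (h.ex_ne_one hi hi')).div_const
      (sqLength i)
  simp only [coef_eq, coefDeriv, eig_eq _ _ hi hi', ha]
  exact hd

/-- An eigenvector of `X` is orthogonal to a bracket of eigenvectors unless the eigenvalues add up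
to zero. -/
theorem add_mul_form_lie_eq_zero {X x y z : Current} {a b c : ℂ} (hx : ⁅X, x⁆ = a • x)
    (hy : ⁅X, y⁆ = b • y) (hz : ⁅X, z⁆ = c • z) : (a + b + c) * Current.form x ⁅y, z⁆ = 0 := by
  have h1 : Current.form ⁅x, X⁆ ⁅y, z⁆ = Current.form x ⁅X, ⁅y, z⁆⁆ := form_lie _ _ _
  rw [← lie_skew, hx, leibniz_lie, hy, hz, smul_lie, lie_smul] at h1
  simp only [map_neg, map_smul, map_add, LinearMap.neg_apply, LinearMap.smul_apply,
    smul_eq_mul] at h1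
  linear_combination -h1

theorem form_lie_left (x y z : Current) :
    Current.form y ⁅x, z⁆ = -Current.form x ⁅y, z⁆ := by
  rw [← form_lie, ← lie_skew, map_neg, LinearMap.neg_apply, form_lie]

/-- The contribution of the parameter derivatives in which `sndFactor i` is paired with `h` or
`c`. -/
def derivTerm (τ lam : ℂ) (i j k : Label) : ℂ :=
  (Current.form h0 (sndFactor i) * wt j - Current.form cc (sndFactor i) * deg j)
    * (2 * Real.pi * Complex.I * (eig τ lam j ^ 2 - eig τ lam j)
      * Current.form (sndFactor j) (sndFactor k))

theorem derivTerm_swap {τ lam : ℂ} (h : Admissible τ lam) (i j k : Label) :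
    derivTerm τ lam i k j = -derivTerm τ lam i j k := by
  rw [derivTerm, derivTerm, form_comm (sndFactor k)]
  by_cases hB : Current.form (sndFactor j) (sndFactor k) = 0
  · simp [hB]
  · obtain ⟨hj, rfl⟩ := eq_opp_of_form_snd_ne_zero hB
    rw [eig_opp h hj, wt_opp, deg_opp]
    push_cast
    ring

/-- The dynamical Yang-Baxter equation evaluated on three weight vectors. -/
def DynamicalYBE (τ lam : ℂ) (i j k : Label) : Prop :=
  ((1 - eig τ lam i) * (1 - eig τ lam j) * (1 - eig τ lam k)
      + eig τ lam i * eig τ lam j * eig τ lam k)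
      * Current.form (sndFactor i) ⁅sndFactor j, sndFactor k⁆
    = derivTerm τ lam i j k - derivTerm τ lam j i k + derivTerm τ lam k i j

theorem DynamicalYBE.swap_left {τ lam : ℂ} (h : Admissible τ lam) {i j k : Label}
    (H : DynamicalYBE τ lam i j k) : DynamicalYBE τ lam j i k := by
  rw [DynamicalYBE] at *
  rw [form_lie_left, derivTerm_swap h k i j]
  linear_combination -H

theorem DynamicalYBE.swap_right {τ lam : ℂ} (h : Admissible τ lam) {i j k : Label}
    (H : DynamicalYBE τ lam i j k) : DynamicalYBE τ lam i k j := by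
  rw [DynamicalYBE] at *
  rw [← lie_skew, map_neg, derivTerm_swap h i j k]
  linear_combination -H

theorem form_h0_snd {i : Label} (hi : i ≠ .hh 0) : Current.form h0 (sndFactor i) = 0 := by
  by_contra h
  exact hi (eq_opp_of_form_snd_ne_zero (i := .hh 0) h).2

theorem form_h0_h0 : Current.form h0 (sndFactor (.hh 0)) = (2 * Real.pi * Complex.I : ℂ)⁻¹ * 2 := by
  classical
  exact (form_snd_snd (i := .hh 0) (by simp) (.hh 0)).trans (if_pos rfl)

theorem form_cc_snd {i : Label} (hi : i ≠ .cd) : Current.form cc (sndFactor i) = 0 := by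
  classical
  rw [form_comm, form_snd_cc, if_neg hi]

theorem dynamicalYBE_hh_zero {τ lam : ℂ} (h : Admissible τ lam) (j k : Label) :
    DynamicalYBE τ lam (.hh 0) j k := by
  have hT : Current.form (sndFactor (.hh 0)) ⁅sndFactor j, sndFactor k⁆
      = -2 * wt j * Current.form (sndFactor j) (sndFactor k) := by
    rw [← form_lie]
    change Current.form ⁅h0, _⁆ _ = _
    rw [h0_lie_snd, map_smul, LinearMap.smul_apply, smul_eq_mul]
  have hpi := Complex.two_pi_I_ne_zero
  have h1 : derivTerm τ lam (.hh 0) j k = 2 * wt j * (eig τ lam j ^ 2 - eig τ lam j)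
      * Current.form (sndFactor j) (sndFactor k) := by
    rw [derivTerm, form_h0_h0, form_cc_snd (by simp)]
    field_simp
    ring
  have h2 : ∀ j k, derivTerm τ lam j (.hh 0) k = 0 := fun j k => by simp [derivTerm, wt, deg]
  rw [DynamicalYBE, hT, h1, h2, h2, eig_hh_zero]
  by_cases hB : Current.form (sndFactor j) (sndFactor k) = 0
  · simp [hB]
  · obtain ⟨hj, rfl⟩ := eq_opp_of_form_snd_ne_zero hB
    rw [eig_opp h hj]
    ring

theorem dynamicalYBE_cd {τ lam : ℂ} (h : Admissible τ lam) (j k : Label) :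
    DynamicalYBE τ lam .cd j k := by
  have hT : Current.form (sndFactor .cd) ⁅sndFactor j, sndFactor k⁆
      = 2 * Real.pi * Complex.I * deg j * Current.form (sndFactor j) (sndFactor k) := by
    rw [← form_lie]
    change Current.form ⁅dd, _⁆ _ = _
    rw [dd_lie_snd, map_smul, LinearMap.smul_apply, smul_eq_mul]
  have h1 : derivTerm τ lam .cd j k = -deg j * (2 * Real.pi * Complex.I
      * (eig τ lam j ^ 2 - eig τ lam j) * Current.form (sndFactor j) (sndFactor k)) := by
    rw [derivTerm, form_h0_snd (by simp)]
    change (_ - Current.form cc dd * _) * _ = _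
    rw [form_cc_dd]
    ring
  have h2 : ∀ j k, derivTerm τ lam j .cd k = 0 := fun j k => by simp [derivTerm, wt, deg]
  rw [DynamicalYBE, hT, h1, h2, h2, eig_cd]
  by_cases hB : Current.form (sndFactor j) (sndFactor k) = 0
  · simp [hB]
  · obtain ⟨hj, rfl⟩ := eq_opp_of_form_snd_ne_zero hB
    rw [eig_opp h hj]
    ring

/-- If one of the vectors is `h` or `d`, the pairing reduces to the weights of the other two.
Otherwise both sides vanish, since three exponents of total weight zero have product one. -/
theorem dynamicalYBE {τ lam : ℂ} (h : Admissible τ lam) (i j k : Label) :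
    DynamicalYBE τ lam i j k := by
  by_cases hi : i = .hh 0
  · exact hi ▸ dynamicalYBE_hh_zero h j k
  by_cases hj : j = .hh 0
  · exact hj ▸ (dynamicalYBE_hh_zero h i k).swap_left h
  by_cases hk : k = .hh 0
  · exact hk ▸ ((dynamicalYBE_hh_zero h i j).swap_left h).swap_right h
  by_cases hi' : i = .cd
  · exact hi' ▸ dynamicalYBE_cd h j k
  by_cases hj' : j = .cd
  · exact hj' ▸ (dynamicalYBE_cd h i k).swap_left h
  by_cases hk' : k = .cd
  · exact hk' ▸ ((dynamicalYBE_cd h i j).swap_left h).swap_right h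
  have hzero : ∀ {i}, i ≠ .hh 0 → i ≠ .cd → ∀ j k, derivTerm τ lam i j k = 0 := fun hi hi' j k => by
    rw [derivTerm, form_h0_snd hi, form_cc_snd hi']
    ring
  rw [DynamicalYBE, hzero hi hi', hzero hj hj', hzero hk hk', sub_zero, add_zero]
  by_cases hT : Current.form (sndFactor i) ⁅sndFactor j, sndFactor k⁆ = 0
  · rw [hT, mul_zero]
  have hw : (wt i : ℂ) + wt j + wt k = 0 := by
    have := (mul_eq_zero.mp
      (add_mul_form_lie_eq_zero (h0_lie_snd i) (h0_lie_snd j) (h0_lie_snd k))).resolve_right hT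
    linear_combination -this / 2
  have hd : (deg i : ℂ) + deg j + deg k = 0 := by
    have := (mul_eq_zero.mp
      (add_mul_form_lie_eq_zero (dd_lie_snd i) (dd_lie_snd j) (dd_lie_snd k))).resolve_right hT
    rw [← mul_add, ← mul_add] at this
    exact (mul_eq_zero.mp this).resolve_left Complex.two_pi_I_ne_zero
  have hex : ex (deg i * τ + wt i * lam) * ex (deg j * τ + wt j * lam)
      * ex (deg k * τ + wt k * lam) = 1 := by
    rw [← ex_add, ← ex_add, ← ex_zero]
    congr 1
    linear_combination τ * hd + lam * hw
  refine mul_eq_zero_of_left ?_ _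
  rw [eig_eq _ _ hi' hi, eig_eq _ _ hj' hj, eig_eq _ _ hk' hk]
  have h1 := sub_ne_zero.mpr (h.ex_ne_one hi' hi).symm
  have h2 := sub_ne_zero.mpr (h.ex_ne_one hj' hj).symm
  have h3 := sub_ne_zero.mpr (h.ex_ne_one hk' hk).symm
  generalize ex (deg i * τ + wt i * lam) = P at *
  generalize ex (deg j * τ + wt j * lam) = Q at *
  generalize ex (deg k * τ + wt k * lam) = S at *
  field_simp
  linear_combination -hex

/-! ### The dynamical Yang-Baxter equation -/

/-- The operator of the universal r-matrix and its transpose add up to the identity, as the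
symmetric part of the universal r-matrix is half the Casimir tensor. -/
theorem opRT_coef {τ lam : ℂ} (h : Admissible τ lam) (x : Current) :
    opRT (coef τ lam) x = x - opR (coef τ lam) x := by
  induction x using current_induction with
  | hadd x y hx hy => rw [map_add, map_add, hx, hy]; abel
  | hsmul r x hx => rw [map_smul, map_smul, hx, smul_sub]
  | hc => rw [opRT_cc, opR_cc, coef, one_smul, sub_zero]
  | hs i =>
    rw [opR_snd]
    change _ = _ - eig τ lam i • _
    by_cases hi : i = .cd
    · subst hi
      rw [eig_cd, one_smul, sub_self]
      exact opRT_dd _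
    · rw [opRT_snd _ hi, ← sqLength_opp]
      change eig τ lam (opp i) • _ = _
      rw [eig_opp h hi, sub_smul, one_smul]

theorem opR_coef_snd (τ lam : ℂ) (i : Label) :
    opR (coef τ lam) (sndFactor i) = eig τ lam i • sndFactor i := opR_snd _ _

theorem opR_coefDeriv_snd (τ lam : ℂ) (a : Label → ℤ) (i : Label) :
    opR (coefDeriv τ lam a) (sndFactor i)
      = (2 * Real.pi * Complex.I * a i * (eig τ lam i ^ 2 - eig τ lam i)) • sndFactor i := by
  rw [opR_snd, coefDeriv, mul_div_cancel₀ _ (sqLength_ne_zero i)]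

/-- The dynamical Yang-Baxter equation paired with `x ⊗ y ⊗ z`. -/
theorem dynamicalYBE_form {τ lam : ℂ} (h : Admissible τ lam) (x y z : Current) :
    Current.form x ⁅opRT (coef τ lam) y, opRT (coef τ lam) z⁆
        + Current.form y ⁅opR (coef τ lam) x, opRT (coef τ lam) z⁆
        + Current.form z ⁅opR (coef τ lam) x, opR (coef τ lam) y⁆
      = Current.form h0 x * Current.form (opR (coefDeriv τ lam wt) y) z
        - Current.form h0 y * Current.form (opR (coefDeriv τ lam wt) x) z
        + Current.form h0 z * Current.form (opR (coefDeriv τ lam wt) x) y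
        - Current.form cc x * Current.form (opR (coefDeriv τ lam deg) y) z
        + Current.form cc y * Current.form (opR (coefDeriv τ lam deg) x) z
        - Current.form cc z * Current.form (opR (coefDeriv τ lam deg) x) y := by
  simp only [opRT_coef h]
  have hh0 : Current.form h0 cc = 0 := form_cur_cc _ _
  have hcc := form_cc_cc
  have hlie : ∀ x y, Current.form cc ⁅x, y⁆ = 0 := fun x y => by
    rw [← form_lie, cc_lie, map_zero, LinearMap.zero_apply]
  have hdiag : ∀ (a : Label → ℤ) (x : Current), Current.form (opR (coefDeriv τ lam a) x) cc = 0 :=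
    fun a x => by
      induction x using current_induction with
      | hadd x y hx hy => rw [map_add, map_add, LinearMap.add_apply, hx, hy, add_zero]
      | hsmul r x hx => rw [map_smul, map_smul, LinearMap.smul_apply, hx, smul_zero]
      | hc => rw [opR_cc, map_zero, LinearMap.zero_apply]
      | hs i =>
        classical
        rw [opR_coefDeriv_snd, map_smul, LinearMap.smul_apply, form_snd_cc]
        split_ifs with hi
        · subst hi
          rw [eig_cd]
          simp
        · simp
  induction x using current_induction with
  | hadd u v hu hv =>
    simp only [map_add, map_sub, LinearMap.add_apply, add_lie,
      sub_lie, lie_sub, add_mul, mul_add] at hu hv ⊢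
    linear_combination hu + hv
  | hsmul r u hu =>
    simp only [map_smul, map_sub, LinearMap.smul_apply, smul_lie, smul_eq_mul,
      sub_lie, lie_sub] at hu ⊢
    linear_combination r * hu
  | hc => simp [hh0, hcc, hlie, opR_cc]
  | hs i =>
    induction y using current_induction with
    | hadd u v hu hv =>
      simp only [map_add, map_sub, LinearMap.add_apply, add_lie, lie_add,
        sub_lie, lie_sub, add_mul, mul_add] at hu hv ⊢
      linear_combination hu + hv
    | hsmul r u hu =>
      simp only [map_smul, map_sub, LinearMap.smul_apply, smul_lie, lie_smul, smul_eq_mul,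
        sub_lie, lie_sub] at hu ⊢
      linear_combination r * hu
    | hc => simp [cc_lie, hh0, hcc, hlie, hdiag, opR_cc]
    | hs j =>
      induction z using current_induction with
      | hadd u v hu hv =>
        simp only [map_add, map_sub, LinearMap.add_apply, lie_add,
          sub_lie, lie_sub, add_mul, mul_add] at hu hv ⊢
        linear_combination hu + hv
      | hsmul r u hu =>
        simp only [map_smul, map_sub, LinearMap.smul_apply, lie_smul, smul_eq_mul,
          sub_lie, lie_sub] at hu ⊢
        linear_combination r * hu
      | hc => simp [lie_cc, hh0, hcc, hlie, hdiag, opR_cc]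
      | hs k =>
        have H := dynamicalYBE h i j k
        have hj : Current.form (sndFactor j) ⁅sndFactor i, sndFactor k⁆
            = -Current.form (sndFactor i) ⁅sndFactor j, sndFactor k⁆ := form_lie_left _ _ _
        have hk : Current.form (sndFactor k) ⁅sndFactor i, sndFactor j⁆
            = Current.form (sndFactor i) ⁅sndFactor j, sndFactor k⁆ := by
          rw [form_comm, form_lie]
        simp only [DynamicalYBE, derivTerm] at H
        simp only [opR_coef_snd, opR_coefDeriv_snd, lie_sub, sub_lie, lie_smul, smul_lie, map_sub,
          map_smul, LinearMap.smul_apply, smul_eq_mul, hj, hk]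
        linear_combination H

end EllipticCurrent

end

open EllipticCurrent
theorem proposition6 :
    -- the universal r-matrix, a family of elements of the completed tensor square
    ∃ r : ℂ → ℂ → Module.Dual ℂ T2,
      (∀ τ lam : ℂ, Admissible τ lam → HasSum2 (rTerm τ lam) (r τ lam)) ∧
      ∀ τ lam : ℂ, Admissible τ lam →
        -- its derivatives in `lam` and `τ`, and the three commutators
        ∃ (rlam rtau : Module.Dual ℂ T2) (A B C : Module.Dual ℂ T3),
          HasDeriv2 (fun l => r τ l) rlam lam ∧
          HasDeriv2 (fun t => r t lam) rtau τ ∧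
          HasSum3 (fun p : Label × Label => br12_13 (rTerm τ lam p.1) (rTerm τ lam p.2)) A ∧
          HasSum3 (fun p : Label × Label => br12_23 (rTerm τ lam p.1) (rTerm τ lam p.2)) B ∧
          HasSum3 (fun p : Label × Label => br13_23 (rTerm τ lam p.1) (rTerm τ lam p.2)) C ∧
          A + B + C =
            mul1_23 h0 rlam - mul2_13 h0 rlam + mul3_12 h0 rlam
              - mul1_23 cc rtau + mul2_13 cc rtau - mul3_12 cc rtau := by
  refine ⟨fun τ lam => diagTensor (coef τ lam), fun τ lam _ => ?_, fun τ lam h => ?_⟩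
  · simp only [funext (rTerm_eq τ lam)]
    exact hasSum2_diagTensor _
  simp only [rTerm_eq]
  refine ⟨diagTensor (coefDeriv τ lam wt), diagTensor (coefDeriv τ lam deg), _, _, _,
    hasDeriv2_diagTensor fun i => ?_, hasDeriv2_diagTensor fun i => ?_, hasSum3_br12_13 _,
    hasSum3_br12_23 _, hasSum3_br13_23 _, ?_⟩
  · exact hasDerivAt_coef (p := fun _ => τ) (q := fun l => l) h (hasDerivAt_const _ _)
      (hasDerivAt_id _) i wt (by simp)
  · exact hasDerivAt_coef (p := fun t => t) (q := fun _ => lam) h (hasDerivAt_id _)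
      (hasDerivAt_const _ _) i deg (by simp)
  · refine TensorProduct.ext' fun x θ => ?_
    induction θ using TensorProduct.induction_on with
    | zero => simp only [TensorProduct.tmul_zero, map_zero]
    | add θ θ' hθ hθ' => rw [TensorProduct.tmul_add, map_add, map_add, hθ, hθ']
    | tmul y z =>
      refine Eq.trans ?_ ((dynamicalYBE_form h x y z).trans ?_)
      · rfl
      · simp only [LinearMap.add_apply, LinearMap.sub_apply]
        rfl
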